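/- Let $n\ge 1$, $N=n+1$, $G=\mathrm{SL}_{N}(\mathbb C)$ with the invariant form $(X,Y)=\mathrm{Tr}(XY)$ on its Lie algebra. Index rows and columns of matrices by $0,\dots,n$, let $E_{i,j}$ be the matrix units, $U_{(i,j)}=\exp(\mathbb C E_{i,j})$, and $\Pi=(\delta_{i+1,j})$ (indices mod $N$). Put $\hat\Pi=\mathrm{diag}(1,\dots,1,-1)\,\Pi$ if $n$ is odd and $\hat\Pi=\Pi$ if $n$ is even. With $\zeta=e^{2\pi\sqrt{-1}/N}$, for $m\in\{0,1\}$ let $R_m$ be the set of pairs $(i,j)$ for which $\zeta^i-\zeta^j$ is a negative real multiple of $e^{\sqrt{-1}\vartheta_m}$, where $\vartheta_m=-\frac{\pi}{N}(1+m)$ if $n$ is odd and $\vartheta_m=-\frac{\pi}{N}(\frac12+m)$ if $n$ is even; explicitly, with $c=\lfloor n/2\rfloor$, $$R_m=\{(i,j): i>j,\ i+j=c-m\}\cup\{(i,j): i<j,\ i+j=c+N-m\}.$$ Let $$\Sigma=\Bigl(\prod_{\alpha\in R_0}U_\alpha\Bigr)\Bigl(\prod_{\alpha\in R_1}U_\alpha\Bigr)\hat\Pi\subset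 G$$ (a Steinberg cross section of the regular conjugacy classes), and let $$\mathcal Z=\{(B,A)\in G\times\Sigma : BA=AB\}\subset G\times G$$ be the universal centralizer, with units $\epsilon(A)=(I,A)$, $A\in\Sigma$. Each $A\in\Sigma$ is uniquely $A=Q_0Q_1\hat\Pi$ with $Q_m=Q_m(A)\in\prod_{\alpha\in R_m}U_\alpha$ $(m=0,1)$; define $Q_m=Q_m(A)$ for all $m\in\mathbb Z$ by $Q_{m+2}=\hat\Pi Q_m\hat\Pi^{-1}$. Let $C$ be the matrix with entry $1$ where $i+j\equiv 0 \bmod N$ and $0$ elsewhere, and $\tilde C=\mathrm{diag}(1,-1,\dots,-1)\,C$. Put $F_\sigma(A)=\hat\Pi^{N/2}$, $F_\theta(A)=\overline{\tilde C\,Q_{-1}(A)}$ if $n$ is odd, and $F_\sigma(A)=(Q_0Q_1\cdots Q_n)^T$, $F_\theta(A)=C$ if $n$ is even. With $\mathrm{Ad}_F X=FXF^{-1}$, let $$\sigma(B,A)=(\mathrm{Ad}_{F_\sigma(A)}B^{-T},\ \mathrm{Ad}_{F_\sigma(A)}A^{-T}),\qquad \theta(B,A)=(\mathrm{Ad}_{F_\theta(A)}\overline{B},\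 \mathrm{Ad}_{F_\theta(A)}\overline{A}^{\,-1}).$$ Let $\theta^L,\theta^R$ be the left and right Maurer–Cartan forms of $G$ and $\omega_{\mathbb C}$ the restriction to $\mathcal Z$ of the 2-form on $G\times G$ given at $(g,a)$ by $$\tfrac12\bigl[(\mathrm{Ad}_a\,\mathrm{pr}_1^*\theta^L,\mathrm{pr}_1^*\theta^L)+(\mathrm{pr}_1^*\theta^L,\mathrm{pr}_2^*(\theta^L+\theta^R))\bigr],$$ where $(\alpha,\beta)(u,v)=(\alpha(u),\beta(v))-(\alpha(v),\beta(u))$. **Theorem.** The maps $\sigma$ and $\theta$ are smooth maps from $\mathcal Z$ to itself, and along the units $\epsilon(\Sigma)$, i.e. at every point $p=(I,A)$ with $A\in\Sigma$ and for all real tangent vectors $u,v\in T_p\mathcal Z$: (i) $\sigma^*\omega_{\mathbb C}=\omega_{\mathbb C}$, that is, $(\omega_{\mathbb C})_{\sigma(p)}(d\sigma_p u,d\sigma_p v)=(\omega_{\mathbb C})_p(u,v)$; (ii) $\theta^*\omega_{\mathbb C}=-\overline{\omega}_{\mathbb C}$, that is, $(\omega_{\mathbb C})_{\theta(p)}(d\theta_p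 u,d\theta_p v)=-\overline{(\omega_{\mathbb C})_p(u,v)}$. -/

import Mathlib

open scoped ContDiff Matrix

attribute [local instance] Matrix.normedAddCommGroup Matrix.normedSpace

noncomputable section

namespace Steinberg

/-- Complex square matrices of size `n + 1`, with rows and columns indexed by `0, …, n`. -/
abbrev Mat (n : ℕ) : Type := Matrix (Fin (n + 1)) (Fin (n + 1)) ℂ

/-! ### The space of Stokes data -/

/-- The matrix `Π̂ = diag(1, …, 1, -1) Π` if `n` is odd, and `Π` if `n` is even, where `Π` is the
cyclic permutation matrix with entries `1` in the positions `(i, i + 1)`, `i` modulo `n + 1`. -/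
def cyc (n : ℕ) : Mat n := Matrix.of fun i j =>
  if j = i + 1 then (if Odd n ∧ i = Fin.last n then -1 else 1) else 0

/-- The singular direction `θ_k` for `k = 1 + m / (n + 1)`. -/
def singularDirection (n : ℕ) (m : ℤ) : ℝ :=
  if Odd n then -(Real.pi / (n + 1)) - m / (n + 1) * Real.pi
  else -(Real.pi / (2 * (n + 1))) - m / (n + 1) * Real.pi

/-- The primitive root of unity `exp(2πi / (n + 1))`. -/
def zeta (n : ℕ) : ℂ := Complex.exp (2 * Real.pi * Complex.I / (n + 1))

/-- The set `R_k` of roots `x_i - x_j` (written as pairs `(i, j)`) for `k = 1 + m / (n + 1)`. These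
are the roots for which `exp((ζ^i - ζ^j) / z)` decays at `z = 0` on the whole sector of width `π`
bisected by the singular direction `θ_k`, i.e. `ζ^i - ζ^j` is a negative multiple of
`exp(√-1 θ_k)`; see `mem_roots` for the explicit list in the two cases that are needed. -/
def roots (n : ℕ) (m : ℤ) : Set (Fin (n + 1) × Fin (n + 1)) :=
  {α | ∃ r : ℝ, r < 0 ∧ zeta n ^ (α.1 : ℕ) - zeta n ^ (α.2 : ℕ) =
    r * Complex.exp (Complex.I * singularDirection n m)}

/-- The product of the root subgroups `U_{x_i - x_j} = exp(ℂ E_{i,j})`, `x_i - x_j ∈ R_k`, for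
`k = 1` (`m = 0`) and `k = 1 + 1 / (n + 1)` (`m = 1`). As the products of the root vectors
`E_{i,j}` in question vanish (`roots_tail_ne_head`), it consists of the matrices
`I + ∑ c_{i,j} E_{i,j}`, the sum being over `R_k`. -/
def unipotent (n : ℕ) (m : ℤ) : Set (Mat n) :=
  {X | ∀ i j, (i, j) ∉ roots n m → X i j = (1 : Mat n) i j}

/-- The Steinberg cross section `M_{n+1} = (∏_{R_1} U_α) (∏_{R_{1 + 1/(n+1)}} U_α) Π̂`. -/
def crossSection (n : ℕ) : Set (Mat n) :=
  {A | ∃ X ∈ unipotent n 0, ∃ Y ∈ unipotent n 1, A = X * Y * cyc n}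

open Classical in
/-- The factor `Q_1` (`m = 0`) or `Q_{1 + 1/(n+1)}` (`m = 1`) of
`A = Q_1 Q_{1 + 1/(n+1)} Π̂`, read off from the entries of `A Π̂⁻¹`; see `factor_zero`,
`factor_one`. -/
def factor (n : ℕ) (m : ℤ) (A : Mat n) : Mat n := Matrix.of fun i j =>
  if (i, j) ∈ roots n m then (A * (cyc n)⁻¹) i j else (1 : Mat n) i j

/-- The Stokes factor `Q_k`, `k = 1 + m / (n + 1)`, as a function of `A`: it is obtained from
`Q_1`, `Q_{1 + 1/(n+1)}` by the cyclic symmetry `Q_{k + 2/(n+1)} = Π̂ Q_k Π̂⁻¹`. -/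
def stokesFactor (n : ℕ) (m : ℤ) (A : Mat n) : Mat n :=
  cyc n ^ (m / 2) * factor n (m % 2) A * cyc n ^ (-(m / 2))

/-- The Stokes matrix `S_1 = Q_1 Q_{1 + 1/(n+1)} ⋯ Q_{1 + n/(n+1)}`. -/
def stokesMatrix (n : ℕ) (A : Mat n) : Mat n :=
  ((List.range (n + 1)).map fun m : ℕ => stokesFactor n m A).prod

/-- The matrix `C`, with `1` in the positions `(i, j)` with `i + j ≡ 0` modulo `n + 1`. -/
def matC (n : ℕ) : Mat n := Matrix.of fun i j => if i + j = 0 then 1 else 0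

/-- The matrix `C̃ = diag(1, -1, …, -1) C`. -/
def matCtilde (n : ℕ) : Mat n :=
  Matrix.diagonal (fun i : Fin (n + 1) => if i = 0 then (1 : ℂ) else -1) * matC n

/-- Entrywise complex conjugation. -/
def conjMat {n : ℕ} (X : Mat n) : Mat n := X.map (starRingEnd ℂ)

/-- `F_σ = Π̂^{(n+1)/2}` if `n` is odd, and `F_σ = S_1ᵀ` if `n` is even. -/
def Fsigma (n : ℕ) (A : Mat n) : Mat n :=
  if Odd n then cyc n ^ ((n + 1) / 2) else (stokesMatrix n A)ᵀ

/-- `F_θ` is the complex conjugate of `C̃ Q_{n/(n+1)}` if `n` is odd, and `F_θ = C` if `n` is even.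
The Stokes factor `Q_{n/(n+1)}` is the one with `m = -1`. -/
def Ftheta (n : ℕ) (A : Mat n) : Mat n :=
  if Odd n then conjMat (matCtilde n * stokesFactor n (-1) A) else matC n

/-- `Ad_g X = g X g⁻¹`. -/
def Ad {n : ℕ} (g X : Mat n) : Mat n := g * X * g⁻¹

/-! ### The universal centralizer and the two involutions -/

/-- The universal centralizer of `SL_{n+1}(ℂ)` with respect to `M_{n+1}`, as a subset of the space
of pairs of matrices. -/
def universalCentralizer (n : ℕ) : Set (Mat n × Mat n) :=
  {p | p.1.det = 1 ∧ p.2 ∈ crossSection n ∧ p.1 * p.2 = p.2 * p.1}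

/-- `σ(B, A) = (Ad_{F_σ(A)} B^{-T}, Ad_{F_σ(A)} A^{-T})`. -/
def sigma (n : ℕ) (p : Mat n × Mat n) : Mat n × Mat n :=
  (Ad (Fsigma n p.2) (p.1⁻¹)ᵀ, Ad (Fsigma n p.2) (p.2⁻¹)ᵀ)

/-- `θ(B, A) = (Ad_{F_θ(A)} B̄, Ad_{F_θ(A)} Ā⁻¹)`. -/
def theta (n : ℕ) (p : Mat n × Mat n) : Mat n × Mat n :=
  (Ad (Ftheta n p.2) (conjMat p.1), Ad (Ftheta n p.2) (conjMat p.2)⁻¹)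

/-- The unit `ε(A) = (I, A)`. -/
def unit (n : ℕ) (A : Mat n) : Mat n × Mat n := (1, A)

/-! ### Tangent vectors, the 2-form, and pullbacks -/

/-- `u` is a tangent vector at `p` of the submanifold `Z` of the space of pairs of matrices: the
velocity at `0` of a smooth real curve in `Z` through `p`. -/
def IsTangent {n : ℕ} (Z : Set (Mat n × Mat n)) (p u : Mat n × Mat n) : Prop :=
  ∃ γ : ℝ → Mat n × Mat n, ContDiffAt ℝ ∞ γ 0 ∧ (∀ᶠ t in nhds (0 : ℝ), γ t ∈ Z) ∧
    γ 0 = p ∧ HasDerivAt γ u 0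

/-- `φ` is smooth (over `ℝ`) near every point of `Z`. -/
def IsSmoothAlong {n : ℕ} (φ : Mat n × Mat n → Mat n × Mat n) (Z : Set (Mat n × Mat n)) : Prop :=
  ∀ p ∈ Z, ContDiffAt ℝ ∞ φ p

/-- The left invariant Maurer–Cartan form at `g`. -/
def mcLeft {n : ℕ} (g u : Mat n) : Mat n := g⁻¹ * u

/-- The right invariant Maurer–Cartan form at `g`. -/
def mcRight {n : ℕ} (g u : Mat n) : Mat n := u * g⁻¹

/-- The 2-form `(α, β)(u, v) = (α(u), β(v)) - (α(v), β(u))` obtained from matrix valued 1-forms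
`α`, `β` at a point by means of the invariant bilinear form `(X, Y) = Tr(XY)`. -/
def wedge {n : ℕ} (α β : Mat n × Mat n → Mat n) (u v : Mat n × Mat n) : ℂ :=
  (α u * β v).trace - (α v * β u).trace

/-- The 2-form `½ [(Ad_a pr₁^* θ^L, pr₁^* θ^L) + (pr₁^* θ^L, pr₂^* (θ^L + θ^R))]` at `p = (g, a)`.
Its restriction to tangent vectors of the universal centralizer is the holomorphic symplectic form
`ω_ℂ`. -/
def omega {n : ℕ} (p u v : Mat n × Mat n) : ℂ :=
  1 / 2 * (wedge (fun w => Ad p.2 (mcLeft p.1 w.1)) (fun w => mcLeft p.1 w.1) u v +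
    wedge (fun w => mcLeft p.1 w.1) (fun w => mcLeft p.2 w.2 + mcRight p.2 w.2) u v)

/-- The pullback `(φ^* η)_p (u, v) = η_{φ(p)} (dφ_p u, dφ_p v)`. If `φ` maps a submanifold `Z` to
itself and `u`, `v` are tangent to `Z`, then this depends only on the restrictions of `φ` and `η`
to `Z`. -/
def pullback {n : ℕ} (φ : Mat n × Mat n → Mat n × Mat n)
    (η : Mat n × Mat n → Mat n × Mat n → Mat n × Mat n → ℂ) (p u v : Mat n × Mat n) : ℂ :=
  η (φ p) (fderiv ℝ φ p u) (fderiv ℝ φ p v)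

/-! ### Consistency of the definitions of the roots and of the Stokes factors -/

theorem zeta_pow (n k : ℕ) : zeta n ^ k = Complex.exp (2 * Real.pi * Complex.I * k / (n + 1)) := by
  rw [zeta, ← Complex.exp_nat_mul]
  congr 1
  ring

/-- The key identity for the explicit description of the roots. -/
theorem zeta_pow_sub (n i j : ℕ) (m : ℤ) :
    zeta n ^ i - zeta n ^ j = -(2 * Real.sin (Real.pi * ((i : ℝ) - j) / (n + 1)) *
      Complex.exp (Complex.I * (Real.pi * ((i : ℝ) + j + m - (n / 2 : ℕ)) / (n + 1) : ℝ))) *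
      Complex.exp (Complex.I * singularDirection n m) := by
  have hN : (n : ℂ) + 1 ≠ 0 := by exact_mod_cast Nat.succ_ne_zero n
  have key : Complex.exp (Complex.I * (Real.pi * ((i : ℝ) + j + m - (n / 2 : ℕ)) / (n + 1) : ℝ)) *
      Complex.exp (Complex.I * singularDirection n m) =
      -(Complex.I * Complex.exp (Complex.I * (Real.pi * ((i : ℝ) + j) / (n + 1) : ℝ))) := by
    have h : ∀ x : ℂ, Complex.exp (-Real.pi / 2 * Complex.I + x) =
        -(Complex.I * Complex.exp x) := by
      intro x
      rw [Complex.exp_add, Complex.exp_neg_pi_div_two_mul_I]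
      ring
    rw [← h, ← Complex.exp_add]
    congr 1
    unfold singularDirection
    rcases Nat.even_or_odd' n with ⟨c, rfl | rfl⟩
    · have h1 : ¬ Odd (2 * c) := by simp
      have h2 : 2 * c / 2 = c := by omega
      rw [if_neg h1, h2]
      push_cast at hN ⊢
      have hN' : (c : ℂ) * 2 + 1 ≠ 0 := by rwa [mul_comm]
      rw [← sub_eq_zero]
      field_simp
      ring
    · have h1 : Odd (2 * c + 1) := ⟨c, rfl⟩
      have h2 : (2 * c + 1) / 2 = c := by omega
      rw [if_pos h1, h2]
      push_cast at hN ⊢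
      have e : (2 * c + 1 + 1 : ℂ) = 2 * (c + 1) := by ring
      have hN' : (c : ℂ) + 1 ≠ 0 := by exact_mod_cast Nat.succ_ne_zero c
      rw [e, ← sub_eq_zero]
      field_simp
      ring
  rw [neg_mul, mul_assoc, key, zeta_pow, zeta_pow]
  have e1 : (2 * Real.pi * Complex.I * i / (n + 1) : ℂ) =
      Complex.I * (Real.pi * ((i : ℝ) + j) / (n + 1) : ℝ) +
        (Real.pi * ((i : ℝ) - j) / (n + 1) : ℝ) * Complex.I := by
    push_cast; field_simp; ring
  have e2 : (2 * Real.pi * Complex.I * j / (n + 1) : ℂ) =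
      Complex.I * (Real.pi * ((i : ℝ) + j) / (n + 1) : ℝ) +
        -(Real.pi * ((i : ℝ) - j) / (n + 1) : ℝ) * Complex.I := by
    push_cast; field_simp; ring
  rw [e1, e2, Complex.exp_add, Complex.exp_add, Complex.ofReal_sin, Complex.sin]
  linear_combination (Complex.exp (Complex.I * (Real.pi * ((i : ℝ) + j) / (n + 1) : ℝ)) *
    (Complex.exp ((Real.pi * ((i : ℝ) - j) / (n + 1) : ℝ) * Complex.I) -
      Complex.exp (-(Real.pi * ((i : ℝ) - j) / (n + 1) : ℝ) * Complex.I))) * Complex.I_sq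

/-- The explicit list of the roots in `R_1` (`m = 0`) and `R_{1 + 1/(n+1)}` (`m = 1`). -/
theorem mem_roots {n : ℕ} {m : ℕ} (hm : m ≤ 1) (i j : Fin (n + 1)) :
    (i, j) ∈ roots n m ↔ (j < i ∧ (i : ℕ) + j + m = n / 2) ∨
      (i < j ∧ (i : ℕ) + j + m = n / 2 + n + 1) := by
  have hE := Complex.exp_ne_zero (Complex.I * singularDirection n m)
  have hN : (0 : ℝ) < (n : ℝ) + 1 := by positivity
  have hpi := Real.pi_pos
  have hi := i.2
  have hj := j.2
  set x : ℝ := Real.pi * ((i : ℝ) + j + (m : ℤ) - (n / 2 : ℕ)) / (n + 1) with hx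
  set s : ℝ := Real.sin (Real.pi * ((i : ℝ) - j) / (n + 1)) with hs
  have step : (i, j) ∈ roots n m ↔ Real.sin x * s = 0 ∧ 0 < Real.cos x * s := by
    have hiff : ∀ r : ℝ, (zeta n ^ (i : ℕ) - zeta n ^ (j : ℕ) =
        r * Complex.exp (Complex.I * singularDirection n m)) ↔
        (-(2 * (Real.cos x * s)) = r ∧ Real.sin x * s = 0) := by
      intro r
      rw [zeta_pow_sub n i j m, mul_left_inj' hE, mul_comm Complex.I, Complex.exp_mul_I,
        ← Complex.ofReal_cos, ← Complex.ofReal_sin, Complex.ext_iff]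
      simp only [← hx, ← hs]
      clear_value x s
      simp only [Complex.neg_re, Complex.neg_im, Complex.mul_re, Complex.mul_im, Complex.add_re,
        Complex.add_im, Complex.ofReal_re, Complex.ofReal_im, Complex.I_re, Complex.I_im,
        Complex.re_ofNat, Complex.im_ofNat]
      constructor
      · rintro ⟨h1, h2⟩
        exact ⟨by linarith, by linarith⟩
      · rintro ⟨h1, h2⟩
        exact ⟨by linarith, by linarith⟩
    constructor
    · rintro ⟨r, hr, h⟩
      have := (hiff r).1 h
      exact ⟨this.2, by linarith [this.1]⟩
    · rintro ⟨h1, h2⟩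
      exact ⟨-(2 * (Real.cos x * s)), by linarith, (hiff _).2 ⟨rfl, h1⟩⟩
  have hspos : j < i → 0 < s := by
    intro h
    have h' : (j : ℝ) < i := by exact_mod_cast h
    have h2 : (i : ℝ) < n + 1 := by exact_mod_cast hi
    have h3 : (0 : ℝ) ≤ j := by positivity
    apply Real.sin_pos_of_pos_of_lt_pi
    · apply div_pos _ hN
      exact mul_pos hpi (by linarith)
    · rw [div_lt_iff₀ hN]
      exact mul_lt_mul_of_pos_left (by linarith) hpi
  have hsneg : i < j → s < 0 := by
    intro h
    have h' : (i : ℝ) < j := by exact_mod_cast h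
    have h2 : (j : ℝ) < n + 1 := by exact_mod_cast hj
    have h3 : (0 : ℝ) ≤ i := by positivity
    apply Real.sin_neg_of_neg_of_neg_pi_lt
    · apply div_neg_of_neg_of_pos _ hN
      exact mul_neg_of_pos_of_neg hpi (by linarith)
    · rw [lt_div_iff₀ hN]
      nlinarith
  have hs0 : i = j → s = 0 := by
    rintro rfl
    simp [hs]
  rw [step]
  constructor
  · rintro ⟨h1, h2⟩
    have hsne : s ≠ 0 := by
      rintro h
      simp [h] at h2
    have hij : i ≠ j := fun h => hsne (hs0 h)
    obtain ⟨k, hk⟩ := Real.sin_eq_zero_iff.1 ((mul_eq_zero.1 h1).resolve_right hsne)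
    have hk' : ((i : ℕ) : ℤ) + (j : ℕ) + m - (n / 2 : ℕ) = k * (n + 1) := by
      have : (k : ℝ) * (n + 1) = (i : ℝ) + j + (m : ℤ) - (n / 2 : ℕ) := by
        rw [hx, eq_div_iff hN.ne'] at hk
        have := mul_left_cancel₀ hpi.ne' (by linarith :
          Real.pi * ((k : ℝ) * (n + 1)) = Real.pi * ((i : ℝ) + j + (m : ℤ) - (n / 2 : ℕ)))
        exact this
      have h3 : (((((i : ℕ) : ℤ) + (j : ℕ) + m - (n / 2 : ℕ) : ℤ)) : ℝ) =
          ((k * (n + 1) : ℤ) : ℝ) := by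
        rw [Int.cast_sub, Int.cast_add, Int.cast_add, Int.cast_mul, Int.cast_add, Int.cast_one]
        simp only [Int.cast_natCast] at this ⊢
        linarith
      exact Int.cast_injective h3
    have hij' : (i : ℕ) ≠ j := fun h => hij (Fin.ext h)
    have hk0 : k = 0 ∨ k = 1 := by
      have a1 : -1 < k := by
        by_contra hcon
        have : k ≤ -1 := by omega
        have : k * ((n : ℤ) + 1) ≤ -1 * ((n : ℤ) + 1) :=
          mul_le_mul_of_nonneg_right this (by positivity)
        omega
      have a2 : k < 2 := by
        by_contra hcon
        have : 2 ≤ k := by omega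
        have : 2 * ((n : ℤ) + 1) ≤ k * ((n : ℤ) + 1) :=
          mul_le_mul_of_nonneg_right this (by positivity)
        omega
      omega
    rcases hk0 with rfl | rfl
    · rw [← hk] at h2
      simp at h2
      left
      refine ⟨?_, by omega⟩
      rcases lt_or_gt_of_ne hij with h | h
      · exact absurd h2 (not_lt.2 (hsneg h).le)
      · exact h
    · rw [← hk] at h2
      simp at h2
      right
      refine ⟨?_, by omega⟩
      rcases lt_or_gt_of_ne hij with h | h
      · exact h
      · exact absurd h2 (not_lt.2 (hspos h).le)
  · rintro (⟨h, hsum⟩ | ⟨h, hsum⟩)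
    · have hx0 : x = 0 := by
        have : ((i : ℕ) : ℝ) + (j : ℕ) + m = (n / 2 : ℕ) := by exact_mod_cast hsum
        rw [hx]
        push_cast at this ⊢
        rw [this]
        simp
      rw [hx0]
      simpa using hspos h
    · have hx0 : x = Real.pi := by
        have : ((i : ℕ) : ℝ) + (j : ℕ) + m = (n / 2 : ℕ) + n + 1 := by exact_mod_cast hsum
        rw [hx, div_eq_iff hN.ne']
        push_cast at this ⊢
        rw [this]
        ring
      rw [hx0]
      simpa using hsneg h

theorem mem_roots_zero {n : ℕ} (i j : Fin (n + 1)) :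
    (i, j) ∈ roots n 0 ↔ (j < i ∧ (i : ℕ) + j = n / 2) ∨
      (i < j ∧ (i : ℕ) + j = n / 2 + n + 1) := by
  simpa using mem_roots (n := n) (m := 0) (by norm_num) i j

theorem mem_roots_one {n : ℕ} (i j : Fin (n + 1)) :
    (i, j) ∈ roots n 1 ↔ (j < i ∧ (i : ℕ) + j + 1 = n / 2) ∨
      (i < j ∧ (i : ℕ) + j + 1 = n / 2 + n + 1) := by
  simpa using mem_roots (n := n) (m := 1) (by norm_num) i j

/-- Two root vectors `E_{i,j}`, `E_{k,l}` with roots in `R_1`, or both in `R_{1 + 1/(n+1)}`, have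
product zero, because `j ≠ k`. -/
theorem roots_tail_ne_head {n m : ℕ} (hm : m ≤ 1) {i j k l : Fin (n + 1)}
    (h1 : (i, j) ∈ roots n m) (h2 : (k, l) ∈ roots n m) : j ≠ k := by
  rintro rfl
  rw [mem_roots hm] at h1 h2
  simp only [Fin.lt_def] at h1 h2
  omega

theorem cyc_mul_transpose (n : ℕ) : cyc n * (cyc n)ᵀ = 1 := by
  ext i k
  simp only [cyc, Matrix.mul_apply, Matrix.transpose_apply, Matrix.of_apply, Matrix.one_apply]
  by_cases hik : i = k
  · subst hik
    simp only [ite_mul, zero_mul, Finset.sum_ite_eq', Finset.mem_univ, if_true]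
    split_ifs <;> norm_num
  · have : ¬ (k = i) := fun h => hik h.symm
    simp [hik, this]

/-- The Stokes factors `X`, `Y` can be read off from the entries of `X Y`. -/
theorem unipotent_mul_apply {n : ℕ} {X Y : Mat n} (hX : X ∈ unipotent n 0)
    (hY : Y ∈ unipotent n 1) (i j : Fin (n + 1)) :
    (X * Y) i j = X i j + Y i j - (1 : Mat n) i j := by
  have h : (X - 1) * (Y - 1) = 0 := by
    ext a b
    rw [Matrix.mul_apply]
    apply Finset.sum_eq_zero
    intro c _
    by_cases h1 : (a, c) ∈ roots n 0
    · by_cases h2 : (c, b) ∈ roots n 1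
      · exfalso
        rw [mem_roots_zero] at h1
        rw [mem_roots_one] at h2
        simp only [Fin.lt_def] at h1 h2
        omega
      · simp [hY c b h2]
    · simp [hX a c h1]
  have h' : X * Y = X + Y - 1 := by
    have : (X - 1) * (Y - 1) = X * Y - (X + Y - 1) := by noncomm_ring
    rw [this, sub_eq_zero] at h
    exact h
  rw [h']
  simp

theorem mul_cyc_mul_inv {n : ℕ} (X : Mat n) : X * cyc n * (cyc n)⁻¹ = X := by
  have h : IsUnit (cyc n).det := Matrix.isUnit_det_of_right_inverse (cyc_mul_transpose n)
  rw [Matrix.mul_assoc, Matrix.mul_nonsing_inv _ h, Matrix.mul_one]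

theorem roots_zero_one_disjoint {n : ℕ} {i j : Fin (n + 1)} (h : (i, j) ∈ roots n 0) :
    (i, j) ∉ roots n 1 := by
  intro h2
  rw [mem_roots_zero] at h
  rw [mem_roots_one] at h2
  simp only [Fin.lt_def] at h h2
  omega

/-- `factor n 0` recovers `Q_1` from `A = Q_1 Q_{1 + 1/(n+1)} Π̂`. -/
theorem factor_zero {n : ℕ} {X Y : Mat n} (hX : X ∈ unipotent n 0) (hY : Y ∈ unipotent n 1) :
    factor n 0 (X * Y * cyc n) = X := by
  ext i j
  simp only [factor, Matrix.of_apply, mul_cyc_mul_inv]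
  split_ifs with h
  · rw [unipotent_mul_apply hX hY, hY i j (roots_zero_one_disjoint h)]
    ring
  · exact (hX i j h).symm

/-- `factor n 1` recovers `Q_{1 + 1/(n+1)}` from `A = Q_1 Q_{1 + 1/(n+1)} Π̂`. -/
theorem factor_one {n : ℕ} {X Y : Mat n} (hX : X ∈ unipotent n 0) (hY : Y ∈ unipotent n 1) :
    factor n 1 (X * Y * cyc n) = Y := by
  ext i j
  simp only [factor, Matrix.of_apply, mul_cyc_mul_inv]
  split_ifs with h
  · rw [unipotent_mul_apply hX hY, hX i j (fun h' => roots_zero_one_disjoint h' h)]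
    ring
  · exact (hY i j h).symm

end Steinberg

end

namespace Steinberg

section

variable {n : ℕ}

/-! ### Roots -/

/-! Write `U_m` for `unipotent n m`, `N = n + 1`, and `A_m = Q_m Q_{m+1} Π̂` (`monodromy`), so that
`A = A_0` on the cross section.

That the maps preserve the centralizer comes down to how symmetries of the regular `N`-gon permute
the `U_m`. Conjugation by `Π̂` (rotation) takes `U_m` to `U_{m+2}`. Inverse transpose (reversal of
roots) takes `U_{m+N}` to `U_m`. Conjugation by `C` or `C̃` (reflection) takes `U_m` to `U_{-1-m}`
or `U_{-2-m}`. Moreover `Q_m A_{m+1} = A_m Q_m`, so Stokes factors conjugate `A` along the chain of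
the `A_m`. The matrices `F_σ` and `F_θ` combine these moves so that the factors land in `U_0` and
`U_1` again (`Ad_Fsigma_mem_crossSection`, `Ad_Ftheta_mem_crossSection`).

For the form, differentiating `BA = AB` at `B = I` shows that a tangent vector `(X, a)` at `(I, A)`
has `X` commuting with `A`. Then `ω((X, a), (Y, b)) = Tr(X A⁻¹ b) - Tr(Y A⁻¹ a)` (`omega_unit`). The
derivative of `F(A)` only adds a commutator with `Ad_F A` to the second component, and such a
commutator pairs to zero (`omega_unit_Ad`), so `F` acts as if it were constant. In `σ` the signs
from inverting `B` and `A` cancel; in `θ` only `A` is inverted, which leaves one sign and a complex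
conjugation. -/

theorem zeta_ne_zero (n : ℕ) : zeta n ≠ 0 := Complex.exp_ne_zero _

theorem zeta_pow_succ (n : ℕ) : zeta n ^ (n + 1) = 1 := by
  have hN : (n : ℂ) + 1 ≠ 0 := by exact_mod_cast Nat.succ_ne_zero n
  rw [zeta, ← Complex.exp_nat_mul]
  conv_rhs => rw [← Complex.exp_two_pi_mul_I]
  congr 1
  push_cast
  field_simp

/-- The sum in `Fin (n + 1)` wraps around, which is harmless because `ζ ^ (n + 1) = 1`. -/
theorem zeta_pow_val_add (i j : Fin (n + 1)) :
    zeta n ^ ((i + j : Fin (n + 1)) : ℕ) = zeta n ^ (i : ℕ) * zeta n ^ (j : ℕ) := by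
  rw [Fin.val_add, ← pow_eq_pow_mod _ (zeta_pow_succ n), pow_add]

theorem zeta_pow_val_one (hn : 1 ≤ n) : zeta n ^ ((1 : Fin (n + 1)) : ℕ) = zeta n := by
  obtain ⟨m, rfl⟩ : ∃ m, n = m + 1 := ⟨n - 1, by omega⟩
  simp

theorem normSq_zeta_pow (n i : ℕ) : Complex.normSq (zeta n ^ i) = 1 := by
  have h : ‖zeta n ^ i‖ = 1 := by
    rw [norm_pow, zeta, show (2 * Real.pi * Complex.I / (n + 1) : ℂ) =
      ((2 * Real.pi / (n + 1) : ℝ) : ℂ) * Complex.I by push_cast; ring,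
      Complex.norm_exp_ofReal_mul_I, one_pow]
  rw [Complex.normSq_eq_norm_sq, h, one_pow]

theorem zeta_pow_val_neg (i : Fin (n + 1)) :
    zeta n ^ ((-i : Fin (n + 1)) : ℕ) = (starRingEnd ℂ) (zeta n ^ (i : ℕ)) := by
  have h := zeta_pow_val_add (-i) i
  have hc : (starRingEnd ℂ) (zeta n ^ (i : ℕ)) * zeta n ^ (i : ℕ) = 1 := by
    rw [mul_comm, Complex.mul_conj, normSq_zeta_pow, Complex.ofReal_one]
  rw [neg_add_cancel, Fin.val_zero, pow_zero] at h
  exact mul_right_cancel₀ (pow_ne_zero (i : ℕ) (zeta_ne_zero n)) (h.symm.trans hc.symm)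

/-- The unit vector in the singular direction. -/
noncomputable def singularUnit (n : ℕ) (m : ℤ) : ℂ :=
  Complex.exp (Complex.I * singularDirection n m)

theorem mem_roots_iff {m : ℤ} {i j : Fin (n + 1)} : (i, j) ∈ roots n m ↔
    ∃ r : ℝ, r < 0 ∧ zeta n ^ (i : ℕ) - zeta n ^ (j : ℕ) = r * singularUnit n m := Iff.rfl

theorem singularUnit_add_two (n : ℕ) (m : ℤ) :
    zeta n * singularUnit n (m + 2) = singularUnit n m := by
  have hN : (n : ℂ) + 1 ≠ 0 := by exact_mod_cast Nat.succ_ne_zero n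
  rw [zeta, singularUnit, singularUnit, ← Complex.exp_add]
  congr 1
  unfold singularDirection
  split_ifs <;> push_cast <;> field_simp <;> ring

theorem singularUnit_add_period (n : ℕ) (m : ℤ) :
    singularUnit n (m + (n + 1)) = -singularUnit n m := by
  have hN : (n : ℂ) + 1 ≠ 0 := by exact_mod_cast Nat.succ_ne_zero n
  rw [← neg_one_mul, ← Complex.exp_neg_pi_mul_I, singularUnit, singularUnit, ← Complex.exp_add]
  congr 1
  unfold singularDirection
  split_ifs <;> push_cast <;> field_simp <;> ring

/-- Solving `-ϑ_m = ϑ_{m'}` gives `m' = 2Nϑ_0/π - m`; the base angle `ϑ_0` is `-π/N` or `-π/(2N)`,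
whence the offsets `-2` and `-1`. -/
theorem conj_singularUnit (n : ℕ) (m : ℤ) : (starRingEnd ℂ) (singularUnit n m) =
    singularUnit n ((if Odd n then -2 else -1) - m) := by
  have hN : (n : ℂ) + 1 ≠ 0 := by exact_mod_cast Nat.succ_ne_zero n
  rw [singularUnit, singularUnit, ← Complex.exp_conj, map_mul, Complex.conj_I, Complex.conj_ofReal]
  congr 1
  unfold singularDirection
  split_ifs <;> push_cast <;> field_simp <;> ring

theorem normSq_singularUnit (n : ℕ) (m : ℤ) : Complex.normSq (singularUnit n m) = 1 := by
  rw [Complex.normSq_eq_norm_sq, singularUnit, mul_comm, Complex.norm_exp_ofReal_mul_I, one_pow]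

/-- Multiplication by `ζ` shifts both indices and turns the direction by `2π/N`, which is two steps
of `m`. -/
theorem mem_roots_add_two (hn : 1 ≤ n) {m : ℤ} {i j : Fin (n + 1)} :
    (i, j) ∈ roots n (m + 2) ↔ (i + 1, j + 1) ∈ roots n m := by
  rw [mem_roots_iff, mem_roots_iff]
  refine exists_congr fun r => and_congr_right fun _ => ?_
  rw [zeta_pow_val_add, zeta_pow_val_add, zeta_pow_val_one hn, ← singularUnit_add_two n m,
    ← mul_right_inj' (zeta_ne_zero n)]
  ring_nf

/-- `N` steps turn the direction by `π`, which reverses the sign of `ζ^i - ζ^j`. -/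
theorem mem_roots_add_period {m : ℤ} {i j : Fin (n + 1)} :
    (i, j) ∈ roots n (m + (n + 1)) ↔ (j, i) ∈ roots n m := by
  rw [mem_roots_iff, mem_roots_iff]
  refine exists_congr fun r => and_congr_right fun _ => ?_
  rw [singularUnit_add_period, ← neg_inj]
  ring_nf

theorem mem_roots_neg {m : ℤ} {i j : Fin (n + 1)} :
    (i, j) ∈ roots n ((if Odd n then -2 else -1) - m) ↔ (-i, -j) ∈ roots n m := by
  rw [mem_roots_iff, mem_roots_iff]
  refine exists_congr fun r => and_congr_right fun _ => ?_
  rw [zeta_pow_val_neg, zeta_pow_val_neg, ← conj_singularUnit, ← map_sub,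
    ← (starRingEnd ℂ).injective.eq_iff, map_mul, Complex.conj_conj, Complex.conj_ofReal]

/-- A line meets the unit circle in at most two points, hence two roots with the same singular
direction are not composable. -/
theorem roots_not_composable {m : ℤ} {i j k : Fin (n + 1)} (h : (i, j) ∈ roots n m) :
    (j, k) ∉ roots n m := by
  obtain ⟨r, hr, h⟩ := mem_roots_iff.1 h
  rintro h'
  obtain ⟨s, hs, h'⟩ := mem_roots_iff.1 h'
  have hi := normSq_zeta_pow n i
  have hj := normSq_zeta_pow n j
  have hk := normSq_zeta_pow n k
  have he := normSq_singularUnit n m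
  rw [sub_eq_iff_eq_add.1 h] at hi
  rw [show zeta n ^ (k : ℕ) = zeta n ^ (j : ℕ) - s * singularUnit n m by rw [← h']; ring] at hk
  generalize zeta n ^ (j : ℕ) = b at *
  generalize singularUnit n m = e at *
  simp only [Complex.normSq_apply, Complex.add_re, Complex.add_im, Complex.sub_re, Complex.sub_im,
    Complex.mul_re, Complex.mul_im, Complex.ofReal_re, Complex.ofReal_im] at hi hj hk he
  -- With `b = ζ^j`, both `b + r e` and `b - s e` lie on the unit circle. This forces `r = -2⟨b, e⟩`
  -- and `s = 2⟨b, e⟩`, so `r` and `s` cannot both be negative.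
  have h1 : r * (r + 2 * (b.re * e.re + b.im * e.im)) = 0 := by
    linear_combination hi - hj - r ^ 2 * he
  have h2 : s * (s - 2 * (b.re * e.re + b.im * e.im)) = 0 := by
    linear_combination hk - hj - s ^ 2 * he
  have h1' := (mul_eq_zero.1 h1).resolve_left hr.ne
  have h2' := (mul_eq_zero.1 h2).resolve_left hs.ne
  linarith

/-! ### Unipotent groups attached to singular directions -/

/-- A nonzero term of the product would need two composable roots of the same direction. Hence `X -
1` squares to zero and `X⁻¹ = 2 - X`. -/
theorem sub_one_mul_sub_one {m : ℤ} {X Y : Mat n} (hX : X ∈ unipotent n m)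
    (hY : Y ∈ unipotent n m) : (X - 1) * (Y - 1) = 0 := by
  ext a b
  rw [Matrix.mul_apply]
  refine Finset.sum_eq_zero fun c _ => ?_
  by_cases h1 : (a, c) ∈ roots n m
  · simp [hY c b (roots_not_composable h1)]
  · simp [hX a c h1]

theorem mul_two_sub_of_unipotent {m : ℤ} {X : Mat n} (hX : X ∈ unipotent n m) :
    X * (2 - X) = 1 := by
  have h := sub_one_mul_sub_one hX hX
  have : X * (2 - X) = 1 - (X - 1) * (X - 1) := by noncomm_ring
  rw [this, h, sub_zero]

theorem isUnit_det_of_unipotent {m : ℤ} {X : Mat n} (hX : X ∈ unipotent n m) : IsUnit X.det :=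
  Matrix.isUnit_det_of_right_inverse (mul_two_sub_of_unipotent hX)

theorem inv_mem_unipotent {m : ℤ} {X : Mat n} (hX : X ∈ unipotent n m) :
    X⁻¹ ∈ unipotent n m := by
  rw [Matrix.inv_eq_right_inv (mul_two_sub_of_unipotent hX)]
  intro i j h
  rw [show (2 : Mat n) - X = 1 + 1 - X by rw [one_add_one_eq_two], Matrix.sub_apply,
    Matrix.add_apply, hX i j h, add_sub_cancel_right]

theorem transpose_mem_unipotent {m : ℤ} {X : Mat n} (hX : X ∈ unipotent n (m + (n + 1))) :
    Xᵀ ∈ unipotent n m := by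
  intro i j h
  rw [Matrix.transpose_apply, hX j i (fun h' => h (mem_roots_add_period.1 h')),
    ← Matrix.transpose_apply (1 : Mat n), Matrix.transpose_one]

theorem conjMat_mem_unipotent {m : ℤ} {X : Mat n} (hX : X ∈ unipotent n m) :
    conjMat X ∈ unipotent n m := by
  intro i j h
  rw [conjMat, Matrix.map_apply, hX i j h, Matrix.one_apply]
  split_ifs <;> simp

/-! ### Signed permutation matrices -/

/-- The signed permutation matrix with entries `d i` in the positions `(i, f i)`. -/
def signedPerm (f : Fin (n + 1) ≃ Fin (n + 1)) (d : Fin (n + 1) → ℂ) : Mat n :=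
  Matrix.of fun i j => if j = f i then d i else 0

theorem signedPerm_mul_mul_transpose_apply (f : Fin (n + 1) ≃ Fin (n + 1)) (d : Fin (n + 1) → ℂ)
    (X : Mat n) (i j : Fin (n + 1)) :
    (signedPerm f d * X * (signedPerm f d)ᵀ) i j = d i * X (f i) (f j) * d j := by
  simp [signedPerm, Matrix.mul_apply]

theorem signedPerm_mul_transpose (f : Fin (n + 1) ≃ Fin (n + 1)) {d : Fin (n + 1) → ℂ}
    (hd : ∀ i, d i * d i = 1) : signedPerm f d * (signedPerm f d)ᵀ = 1 := by
  ext i j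
  have h := signedPerm_mul_mul_transpose_apply f d 1 i j
  rw [mul_one] at h
  rw [h, Matrix.one_apply, Matrix.one_apply]
  simp only [f.injective.eq_iff]
  split_ifs with hij
  · subst hij
    rw [mul_one, hd]
  · ring

theorem inv_signedPerm (f : Fin (n + 1) ≃ Fin (n + 1)) {d : Fin (n + 1) → ℂ}
    (hd : ∀ i, d i * d i = 1) : (signedPerm f d)⁻¹ = (signedPerm f d)ᵀ :=
  Matrix.inv_eq_right_inv (signedPerm_mul_transpose f hd)

theorem isUnit_det_signedPerm (f : Fin (n + 1) ≃ Fin (n + 1)) {d : Fin (n + 1) → ℂ}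
    (hd : ∀ i, d i * d i = 1) : IsUnit (signedPerm f d).det :=
  Matrix.isUnit_det_of_right_inverse (signedPerm_mul_transpose f hd)

/-- The signs square to `1` on the diagonal and do not affect which entries vanish, so only the
action of `f` on roots matters. -/
theorem signedPerm_conj_mem_unipotent (f : Fin (n + 1) ≃ Fin (n + 1)) {d : Fin (n + 1) → ℂ}
    (hd : ∀ i, d i * d i = 1) {m m' : ℤ}
    (hf : ∀ i j, (f i, f j) ∈ roots n m → (i, j) ∈ roots n m') {X : Mat n}
    (hX : X ∈ unipotent n m) : signedPerm f d * X * (signedPerm f d)⁻¹ ∈ unipotent n m' := by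
  intro i j h
  rw [inv_signedPerm f hd, signedPerm_mul_mul_transpose_apply,
    hX _ _ (fun h' => h (hf i j h')), Matrix.one_apply, Matrix.one_apply]
  simp only [f.injective.eq_iff]
  split_ifs with hij
  · subst hij
    rw [mul_one, hd]
  · ring

/-- The signs in `Π̂`. -/
noncomputable def cycSign (n : ℕ) (i : Fin (n + 1)) : ℂ := if Odd n ∧ i = Fin.last n then -1 else 1

/-- The signs in `C̃`. -/
noncomputable def tildeSign (n : ℕ) (i : Fin (n + 1)) : ℂ := if i = 0 then 1 else -1

theorem cycSign_mul_self (i : Fin (n + 1)) : cycSign n i * cycSign n i = 1 := by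
  unfold cycSign; split_ifs <;> norm_num

theorem tildeSign_mul_self (i : Fin (n + 1)) : tildeSign n i * tildeSign n i = 1 := by
  unfold tildeSign; split_ifs <;> norm_num

theorem cyc_eq (n : ℕ) : cyc n = signedPerm (Equiv.addRight 1) (cycSign n) := rfl

theorem matC_eq (n : ℕ) : matC n = signedPerm (Equiv.neg _) fun _ => 1 := by
  ext i j
  simp only [matC, signedPerm, Matrix.of_apply, Equiv.neg_apply, eq_neg_iff_add_eq_zero, add_comm]

theorem matCtilde_eq (n : ℕ) : matCtilde n = signedPerm (Equiv.neg _) (tildeSign n) := by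
  ext i j
  simp only [matCtilde, matC, tildeSign, signedPerm, Matrix.diagonal_mul, Matrix.of_apply,
    Equiv.neg_apply, eq_neg_iff_add_eq_zero, add_comm]
  split_ifs <;> simp

theorem isUnit_det_cyc (n : ℕ) : IsUnit (cyc n).det := by
  rw [cyc_eq]; exact isUnit_det_signedPerm _ cycSign_mul_self

theorem inv_cyc (n : ℕ) : (cyc n)⁻¹ = (cyc n)ᵀ := by
  rw [cyc_eq]; exact inv_signedPerm _ cycSign_mul_self

theorem inv_transpose_cyc (n : ℕ) : (cyc n)⁻¹ᵀ = cyc n := by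
  rw [inv_cyc, Matrix.transpose_transpose]

theorem isUnit_det_matC (n : ℕ) : IsUnit (matC n).det := by
  rw [matC_eq]; exact isUnit_det_signedPerm _ fun _ => one_mul 1

theorem isUnit_det_matCtilde (n : ℕ) : IsUnit (matCtilde n).det := by
  rw [matCtilde_eq]; exact isUnit_det_signedPerm _ tildeSign_mul_self

theorem cyc_conj_mem_unipotent (hn : 1 ≤ n) {m : ℤ} {X : Mat n} (hX : X ∈ unipotent n m) :
    cyc n * X * (cyc n)⁻¹ ∈ unipotent n (m + 2) := by
  rw [cyc_eq]
  exact signedPerm_conj_mem_unipotent _ cycSign_mul_self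
    (fun i j h => (mem_roots_add_two hn).2 h) hX

/-- Backward shifts are needed for Stokes factors of negative index, such as `Q_{-1} = Π̂⁻¹ Q_1 Π̂`.
-/
theorem inv_cyc_conj_mem_unipotent (hn : 1 ≤ n) {m : ℤ} {X : Mat n}
    (hX : X ∈ unipotent n (m + 2)) : (cyc n)⁻¹ * X * cyc n ∈ unipotent n m := by
  intro i j h
  set Y := (cyc n)⁻¹ * X * cyc n with hY
  have hXY : X = cyc n * Y * (cyc n)⁻¹ := by
    have hu := isUnit_det_cyc n
    rw [hY, Matrix.mul_assoc (cyc n)⁻¹, Matrix.mul_nonsing_inv_cancel_left _ _ hu,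
      Matrix.mul_nonsing_inv_cancel_right _ _ hu]
  -- Every index is a successor modulo `N`, so the entries of `Y` can be read off from those of `X =
  -- Π̂ Y Π̂⁻¹`.
  obtain ⟨i, rfl⟩ := (Equiv.addRight (1 : Fin (n + 1))).surjective i
  obtain ⟨j, rfl⟩ := (Equiv.addRight (1 : Fin (n + 1))).surjective j
  have h' := hX i j (fun h' => h ((mem_roots_add_two hn).1 h'))
  rw [hXY, cyc_eq, inv_signedPerm _ cycSign_mul_self, signedPerm_mul_mul_transpose_apply] at h'
  have hi := cycSign_mul_self i
  have hj := cycSign_mul_self j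
  rw [Matrix.one_apply] at h' ⊢
  simp only [(Equiv.addRight (1 : Fin (n + 1))).injective.eq_iff]
  split_ifs at h' ⊢ with hij
  · subst hij
    linear_combination h' - Y _ _ * hi
  · linear_combination cycSign n i * cycSign n j * h' -
      Y _ _ * (hi * cycSign n j * cycSign n j + hj)

theorem cyc_zpow_conj_mem_unipotent (hn : 1 ≤ n) {m : ℤ} {X : Mat n} (hX : X ∈ unipotent n m)
    (k : ℤ) : cyc n ^ k * X * cyc n ^ (-k) ∈ unipotent n (m + 2 * k) := by
  have hu := isUnit_det_cyc n
  induction k with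
  | zero => simpa using hX
  | succ k ih =>
    have h := cyc_conj_mem_unipotent hn ih
    rw [add_comm (k : ℤ) 1, neg_add, add_comm (-1 : ℤ), Matrix.zpow_add hu, Matrix.zpow_add hu,
      Matrix.zpow_neg_one, zpow_one]
    convert h using 1
    · ring_nf
    · simp only [Matrix.mul_assoc]
  | pred k ih =>
    rw [show m + 2 * (-(k : ℤ)) = m + 2 * (-(k : ℤ) - 1) + 2 by ring] at ih
    have h := inv_cyc_conj_mem_unipotent hn ih
    rw [show -(k : ℤ) - 1 = -1 + -k by ring, show -(-1 + -(k : ℤ)) = - -(k : ℤ) + 1 by ring,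
      Matrix.zpow_add hu, Matrix.zpow_add hu, Matrix.zpow_neg_one, zpow_one]
    convert h using 1
    · ring_nf
    · simp only [Matrix.mul_assoc]

theorem matC_conj_mem_unipotent (h : ¬ Odd n) {m : ℤ} {X : Mat n} (hX : X ∈ unipotent n m) :
    matC n * X * (matC n)⁻¹ ∈ unipotent n (-1 - m) := by
  rw [matC_eq]
  refine signedPerm_conj_mem_unipotent _ (fun _ => one_mul 1) (fun i j h' => ?_) hX
  have := mem_roots_neg.2 h'
  rwa [if_neg h] at this

theorem matCtilde_conj_mem_unipotent (h : Odd n) {m : ℤ} {X : Mat n} (hX : X ∈ unipotent n m) :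
    matCtilde n * X * (matCtilde n)⁻¹ ∈ unipotent n (-2 - m) := by
  rw [matCtilde_eq]
  refine signedPerm_conj_mem_unipotent _ tildeSign_mul_self (fun i j h' => ?_) hX
  have := mem_roots_neg.2 h'
  rwa [if_pos h] at this

theorem neg_eq_neg_add_one_iff {i j : Fin (n + 1)} : -i = -j + 1 ↔ j = i + 1 := by
  rw [neg_eq_iff_add_eq_zero, add_comm (-j), ← add_assoc, add_neg_eq_zero, eq_comm]

/-- Negating indices turns the cycle `i ↦ i + 1` into its inverse. -/
theorem matC_conj_inv_cyc (h : ¬ Odd n) : matC n * (cyc n)⁻¹ * (matC n)⁻¹ = cyc n := by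
  ext i j
  rw [inv_cyc, matC_eq, inv_signedPerm _ fun _ => one_mul 1, signedPerm_mul_mul_transpose_apply]
  simp only [Matrix.transpose_apply, cyc, Matrix.of_apply, Equiv.neg_apply, h, false_and, if_false,
    one_mul, mul_one]
  congr 1
  exact propext neg_eq_neg_add_one_iff

/-- Negating indices alone would put the entry `-1` in position `(0, 1)` instead of `(n, 0)`. The
signs of `C̃` flip exactly these two positions of the cycle, and so move it back. -/
theorem matCtilde_conj_inv_cyc (h : Odd n) :
    matCtilde n * (cyc n)⁻¹ * (matCtilde n)⁻¹ = cyc n := by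
  have hn : 1 ≤ n := h.pos
  ext i j
  rw [inv_cyc, matCtilde_eq, inv_signedPerm _ tildeSign_mul_self,
    signedPerm_mul_mul_transpose_apply]
  simp only [Matrix.transpose_apply, cyc, Matrix.of_apply, Equiv.neg_apply, h, true_and]
  by_cases hij : j = i + 1
  · subst hij
    have e1 : -(i + 1) = Fin.last n ↔ i = 0 := by
      rw [neg_eq_iff_add_eq_zero, add_assoc, add_comm 1, Fin.last_add_one, add_zero]
    have e2 : i + 1 = 0 ↔ i = Fin.last n := by
      rw [← Fin.last_add_one n, add_left_inj]
    have e3 : i = 0 → i ≠ Fin.last n := by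
      rintro rfl h'
      have := congrArg Fin.val h'
      simp at this
      omega
    simp only [neg_eq_neg_add_one_iff, tildeSign, e1, e2, if_true]
    by_cases h0 : i = 0
    · have := e3 h0
      simp [h0]
    · simp only [h0, if_false]
      split_ifs <;> norm_num
  · rw [if_neg (fun h' => hij (neg_eq_neg_add_one_iff.1 h')), if_neg hij]
    ring

/-! ### Conjugation and complex conjugation -/

theorem Ad_mul {g : Mat n} (hg : IsUnit g.det) (X Y : Mat n) : Ad g (X * Y) = Ad g X * Ad g Y := by
  simp only [Ad, Matrix.mul_assoc, Matrix.nonsing_inv_mul_cancel_left _ _ hg]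

theorem Ad_one {g : Mat n} (hg : IsUnit g.det) : Ad g 1 = 1 := by
  rw [Ad, Matrix.mul_one, Matrix.mul_nonsing_inv _ hg]

theorem Ad_Ad (g h X : Mat n) : Ad g (Ad h X) = Ad (g * h) X := by
  simp only [Ad, Matrix.mul_inv_rev, Matrix.mul_assoc]

theorem Ad_inv {g : Mat n} (hg : IsUnit g.det) (X : Mat n) : Ad g X⁻¹ = (Ad g X)⁻¹ := by
  rw [Ad, Ad, Matrix.mul_inv_rev, Matrix.mul_inv_rev, Matrix.nonsing_inv_nonsing_inv _ hg,
    Matrix.mul_assoc]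

theorem det_Ad {g : Mat n} (hg : IsUnit g.det) (X : Mat n) : (Ad g X).det = X.det :=
  Matrix.det_conj ((Matrix.isUnit_iff_isUnit_det g).2 hg) X

theorem trace_Ad {g : Mat n} (hg : IsUnit g.det) (X : Mat n) : (Ad g X).trace = X.trace := by
  rw [Ad, Matrix.trace_mul_comm, Matrix.nonsing_inv_mul_cancel_left _ _ hg]

theorem Ad_eq_of_mul_eq {g X Y : Mat n} (hg : IsUnit g.det) (h : g * X = Y * g) : Ad g X = Y := by
  rw [Ad, h, Matrix.mul_nonsing_inv_cancel_right _ _ hg]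

theorem conjMat_mul (X Y : Mat n) : conjMat (X * Y) = conjMat X * conjMat Y := by
  simp only [conjMat, Matrix.map_mul]

theorem conjMat_one : conjMat (1 : Mat n) = 1 := by
  simp [conjMat]

theorem det_conjMat (X : Mat n) : (conjMat X).det = (starRingEnd ℂ) X.det :=
  (RingHom.map_det _ _).symm

theorem isUnit_det_conjMat {X : Mat n} (h : IsUnit X.det) : IsUnit (conjMat X).det := by
  rw [det_conjMat]; exact h.map _

theorem conjMat_inv {X : Mat n} (h : IsUnit X.det) : conjMat X⁻¹ = (conjMat X)⁻¹ := by
  refine (Matrix.inv_eq_right_inv ?_).symm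
  rw [← conjMat_mul, Matrix.mul_nonsing_inv _ h, conjMat_one]

theorem conjMat_cyc (n : ℕ) : conjMat (cyc n) = cyc n := by
  ext i j
  simp only [conjMat, cyc, Matrix.map_apply, Matrix.of_apply]
  split_ifs <;> simp

theorem conjMat_matCtilde (n : ℕ) : conjMat (matCtilde n) = matCtilde n := by
  ext i j
  simp only [conjMat, matCtilde, matC, Matrix.diagonal_mul, Matrix.map_apply, Matrix.of_apply]
  split_ifs <;> simp

/-! ### Stokes factors -/

theorem factor_mem_unipotent (n : ℕ) (m : ℤ) (A : Mat n) : factor n m A ∈ unipotent n m := by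
  intro i j h
  simp [factor, h]

theorem stokesFactor_mem_unipotent (hn : 1 ≤ n) (m : ℤ) (A : Mat n) :
    stokesFactor n m A ∈ unipotent n m := by
  have h := cyc_zpow_conj_mem_unipotent hn (factor_mem_unipotent n (m % 2) A) (m / 2)
  rwa [Int.emod_add_mul_ediv] at h

theorem isUnit_det_stokesFactor (hn : 1 ≤ n) (m : ℤ) (A : Mat n) :
    IsUnit (stokesFactor n m A).det :=
  isUnit_det_of_unipotent (stokesFactor_mem_unipotent hn m A)

theorem stokesFactor_add_two_mul_cyc (m : ℤ) (A : Mat n) :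
    stokesFactor n (m + 2) A * cyc n = cyc n * stokesFactor n m A := by
  have hu := isUnit_det_cyc n
  have e1 : (m + 2) / 2 = 1 + m / 2 := by omega
  have e2 : (m + 2) % 2 = m % 2 := by omega
  rw [stokesFactor, stokesFactor, e1, e2, neg_add, add_comm (-1 : ℤ), Matrix.zpow_add hu,
    Matrix.zpow_add hu, Matrix.zpow_neg_one, zpow_one]
  simp only [Matrix.mul_assoc, Matrix.nonsing_inv_mul _ hu, Matrix.mul_one]

theorem eq_stokesFactor_mul {A : Mat n} (hA : A ∈ crossSection n) :
    A = stokesFactor n 0 A * stokesFactor n 1 A * cyc n := by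
  obtain ⟨X, hX, Y, hY, rfl⟩ := hA
  have h0 : stokesFactor n 0 (X * Y * cyc n) = X := by simp [stokesFactor, factor_zero hX hY]
  have h1 : stokesFactor n 1 (X * Y * cyc n) = Y := by simp [stokesFactor, factor_one hX hY]
  rw [h0, h1]

/-- The matrices `Q_m Q_{m+1} Π̂`; for `m = 0` one obtains `A`. -/
noncomputable def monodromy (n : ℕ) (m : ℤ) (A : Mat n) : Mat n :=
  stokesFactor n m A * stokesFactor n (m + 1) A * cyc n

/-- `Q_m Q_{m+1} (Q_{m+2} Π̂) = Q_m Q_{m+1} Π̂ Q_m` by the cyclic symmetry. -/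
theorem stokesFactor_mul_monodromy (m : ℤ) (A : Mat n) :
    stokesFactor n m A * monodromy n (m + 1) A = monodromy n m A * stokesFactor n m A := by
  rw [monodromy, monodromy, show m + 1 + 1 = m + 2 by ring]
  simp only [Matrix.mul_assoc, stokesFactor_add_two_mul_cyc]

/-- The previous relation telescopes; for `k = n + 1` the product is `S_1`, which therefore
conjugates `A_N` into `A_0`. -/
theorem stokesFactor_prod_mul_monodromy (A : Mat n) (k : ℕ) :
    ((List.range k).map fun m : ℕ => stokesFactor n m A).prod * monodromy n k A =
      monodromy n 0 A * ((List.range k).map fun m : ℕ => stokesFactor n m A).prod := by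
  induction k with
  | zero => simp
  | succ k ih =>
    rw [List.range_succ, List.map_append, List.prod_append, List.map_singleton,
      List.prod_singleton, Nat.cast_succ, mul_assoc, stokesFactor_mul_monodromy, ← mul_assoc, ih,
      mul_assoc]

theorem isUnit_det_stokesMatrix (hn : 1 ≤ n) (A : Mat n) : IsUnit (stokesMatrix n A).det := by
  have h : ∀ k : ℕ, IsUnit ((List.range k).map fun m : ℕ => stokesFactor n m A).prod := by
    intro k
    induction k with
    | zero => simp
    | succ k ih =>
      rw [List.range_succ, List.map_append, List.prod_append, List.map_singleton,
        List.prod_singleton]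
      exact ih.mul ((Matrix.isUnit_iff_isUnit_det _).2 (isUnit_det_stokesFactor hn _ A))
  exact (Matrix.isUnit_iff_isUnit_det _).1 (h (n + 1))

theorem isUnit_det_crossSection {A : Mat n} (hA : A ∈ crossSection n) : IsUnit A.det := by
  obtain ⟨X, hX, Y, hY, rfl⟩ := hA
  rw [Matrix.det_mul, Matrix.det_mul]
  exact ((isUnit_det_of_unipotent hX).mul (isUnit_det_of_unipotent hY)).mul (isUnit_det_cyc n)

theorem isUnit_det_Fsigma (hn : 1 ≤ n) (A : Mat n) : IsUnit (Fsigma n A).det := by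
  unfold Fsigma
  split_ifs
  · rw [Matrix.det_pow]; exact (isUnit_det_cyc n).pow _
  · rw [Matrix.det_transpose]; exact isUnit_det_stokesMatrix hn A

theorem isUnit_det_Ftheta (hn : 1 ≤ n) (A : Mat n) : IsUnit (Ftheta n A).det := by
  unfold Ftheta
  split_ifs
  · refine isUnit_det_conjMat ?_
    rw [Matrix.det_mul]
    exact (isUnit_det_matCtilde n).mul (isUnit_det_stokesFactor hn _ A)
  · exact isUnit_det_matC n

/-! ### The involutions preserve the universal centralizer -/

theorem inv_transpose_monodromy (m : ℤ) (A : Mat n) : ((monodromy n m A)⁻¹)ᵀ =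
    ((stokesFactor n m A)⁻¹)ᵀ * ((stokesFactor n (m + 1) A)⁻¹)ᵀ * cyc n := by
  rw [monodromy, Matrix.mul_inv_rev, Matrix.mul_inv_rev, Matrix.transpose_mul,
    Matrix.transpose_mul, inv_transpose_cyc]

/-- Inverse transpose fixes `Π̂` and lowers `m` by `N`. For odd `n`, conjugation by `Π̂^{N/2}`
raises it again by `N`. For even `n`, `N` is odd and no power of `Π̂` does this; instead `Ad_{Sᵀ}
A^{-T} = (S⁻¹ A S)^{-T} = A_N^{-T}`, whose factors come from `U_N` and `U_{N+1}`. -/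
theorem Ad_Fsigma_mem_crossSection (hn : 1 ≤ n) {A : Mat n} (hA : A ∈ crossSection n) :
    Ad (Fsigma n A) (A⁻¹)ᵀ ∈ crossSection n := by
  have hA0 : A = monodromy n 0 A := eq_stokesFactor_mul hA
  by_cases h : Odd n
  · have hu := isUnit_det_cyc n
    have hF : Fsigma n A = cyc n ^ (((n + 1) / 2 : ℕ) : ℤ) := by
      rw [Fsigma, if_pos h, zpow_natCast]
    have hK : 2 * (((n + 1) / 2 : ℕ) : ℤ) = n + 1 := by
      obtain ⟨c, rfl⟩ := h
      push_cast
      omega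
    have hFu := isUnit_det_Fsigma hn A
    have key : ∀ m : ℤ, Ad (Fsigma n A) ((stokesFactor n m A)⁻¹)ᵀ ∈ unipotent n m := by
      intro m
      have h1 : ((stokesFactor n m A)⁻¹)ᵀ ∈ unipotent n (m - (n + 1)) :=
        transpose_mem_unipotent (by
          rw [sub_add_cancel]
          exact inv_mem_unipotent (stokesFactor_mem_unipotent hn m A))
      have h2 := cyc_zpow_conj_mem_unipotent hn h1 (((n + 1) / 2 : ℕ) : ℤ)
      rwa [hK, sub_add_cancel, Matrix.zpow_neg hu, ← hF] at h2
    refine ⟨_, key 0, _, key 1, ?_⟩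
    have hc : Ad (Fsigma n A) (cyc n) = cyc n :=
      Ad_eq_of_mul_eq hFu (by rw [Fsigma, if_pos h, ← pow_succ, ← pow_succ'])
    conv_lhs => rw [hA0, inv_transpose_monodromy, ← hA0]
    rw [Ad_mul hFu, Ad_mul hFu, hc, zero_add]
  · have hS := isUnit_det_stokesMatrix hn A
    have h1 := stokesFactor_prod_mul_monodromy A (n + 1)
    rw [← stokesMatrix, ← hA0] at h1
    have h2 : Ad (Fsigma n A) (A⁻¹)ᵀ = ((monodromy n ((n + 1 : ℕ) : ℤ) A)⁻¹)ᵀ := by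
      have h3 : monodromy n ((n + 1 : ℕ) : ℤ) A = (stokesMatrix n A)⁻¹ * A * stokesMatrix n A := by
        rw [Matrix.mul_assoc, ← h1, Matrix.nonsing_inv_mul_cancel_left _ _ hS]
      rw [h3, Fsigma, if_neg h, Ad, Matrix.mul_inv_rev, Matrix.mul_inv_rev,
        Matrix.nonsing_inv_nonsing_inv _ hS, Matrix.transpose_mul, Matrix.transpose_mul,
        Matrix.transpose_nonsing_inv (stokesMatrix n A)]
    have key : ∀ m : ℤ, ((stokesFactor n (m + (n + 1)) A)⁻¹)ᵀ ∈ unipotent n m := fun m =>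
      transpose_mem_unipotent (inv_mem_unipotent (stokesFactor_mem_unipotent hn _ A))
    refine ⟨_, key 0, _, key 1, ?_⟩
    rw [h2, inv_transpose_monodromy, zero_add, add_comm (1 : ℤ), Nat.cast_succ]

/-- Inversion reverses the order of the factors and reflection restores it. For even `n`, `m ↦ -1 -
m` sends the indices `1, 0` of `A_0` to `-2, -1`. For odd `n`, `m ↦ -2 - m` does so for the indices
`0, -1` of `A_{-1}`, so `A` is first conjugated into `A_{-1}` by `Q_{-1}`. -/
theorem Ad_Ftheta_mem_crossSection (hn : 1 ≤ n) {A : Mat n} (hA : A ∈ crossSection n) :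
    Ad (Ftheta n A) (conjMat A)⁻¹ ∈ crossSection n := by
  have hu := isUnit_det_cyc n
  have hA0 : A = monodromy n 0 A := eq_stokesFactor_mul hA
  -- After inversion the factor `Π̂` stands on the left; moving it to the right raises both indices
  -- by two.
  have swap : ∀ {X Y : Mat n}, X ∈ unipotent n (-2) → Y ∈ unipotent n (-1) →
      cyc n * X * Y ∈ crossSection n := by
    intro X Y hX hY
    have hX' := cyc_conj_mem_unipotent hn hX
    have hY' := cyc_conj_mem_unipotent hn hY
    rw [neg_add_cancel] at hX'
    rw [show (-1 : ℤ) + 2 = 1 by norm_num] at hY'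
    refine ⟨_, hX', _, hY', ?_⟩
    simp only [Matrix.mul_assoc, Matrix.nonsing_inv_mul_cancel_left _ _ hu,
      Matrix.nonsing_inv_mul _ hu, Matrix.mul_one]
  by_cases h : Odd n
  · have hQ := isUnit_det_stokesFactor hn (-1) A
    have hC := isUnit_det_matCtilde n
    have h1 : Ad (stokesFactor n (-1) A) A = monodromy n (-1) A := by
      have h0 := stokesFactor_mul_monodromy (-1) A
      rw [neg_add_cancel, ← hA0] at h0
      exact Ad_eq_of_mul_eq hQ h0
    have h2 : Ad (Ftheta n A) (conjMat A)⁻¹ =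
        Ad (matCtilde n) (conjMat (monodromy n (-1) A))⁻¹ := by
      rw [← h1, Ftheta, if_pos h, conjMat_mul, conjMat_matCtilde, ← Ad_Ad,
        Ad_inv (isUnit_det_conjMat hQ)]
      simp only [Ad, conjMat_mul, conjMat_inv hQ]
    have e2 := matCtilde_conj_mem_unipotent h (inv_mem_unipotent (conjMat_mem_unipotent
      (stokesFactor_mem_unipotent hn 0 A)))
    have e1 := matCtilde_conj_mem_unipotent h (inv_mem_unipotent (conjMat_mem_unipotent
      (stokesFactor_mem_unipotent hn (-1) A)))
    rw [sub_zero] at e2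
    rw [show (-2 : ℤ) - -1 = -1 by norm_num] at e1
    have h3 := swap e2 e1
    rw [h2, monodromy, neg_add_cancel, conjMat_mul, conjMat_mul, conjMat_cyc, Matrix.mul_inv_rev,
      Matrix.mul_inv_rev, Ad_mul hC, Ad_mul hC, ← Matrix.mul_assoc]
    simp only [Ad, matCtilde_conj_inv_cyc h]
    exact h3
  · have hC := isUnit_det_matC n
    have e2 := matC_conj_mem_unipotent h (inv_mem_unipotent (conjMat_mem_unipotent
      (stokesFactor_mem_unipotent hn 1 A)))
    have e1 := matC_conj_mem_unipotent h (inv_mem_unipotent (conjMat_mem_unipotent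
      (stokesFactor_mem_unipotent hn 0 A)))
    rw [show (-1 : ℤ) - 1 = -2 by norm_num] at e2
    rw [sub_zero] at e1
    have h3 := swap e2 e1
    have hA1 : conjMat A = conjMat (stokesFactor n 0 A * stokesFactor n 1 A * cyc n) :=
      congrArg conjMat (eq_stokesFactor_mul hA)
    rw [Ftheta, if_neg h, hA1, conjMat_mul, conjMat_mul, conjMat_cyc, Matrix.mul_inv_rev,
      Matrix.mul_inv_rev, Ad_mul hC, Ad_mul hC, ← Matrix.mul_assoc]
    simp only [Ad, matC_conj_inv_cyc h]
    exact h3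

theorem inv_mul_comm_of_commute {X Y : Mat n} (h : X * Y = Y * X) : X⁻¹ * Y⁻¹ = Y⁻¹ * X⁻¹ := by
  rw [← Matrix.mul_inv_rev, ← Matrix.mul_inv_rev, h]

theorem mapsTo_sigma (hn : 1 ≤ n) :
    Set.MapsTo (sigma n) (universalCentralizer n) (universalCentralizer n) := by
  rintro ⟨B, A⟩ ⟨hB, hA, hBA⟩
  have hF := isUnit_det_Fsigma hn A
  refine ⟨?_, Ad_Fsigma_mem_crossSection hn hA, ?_⟩
  · simp only [sigma]
    rw [det_Ad hF, Matrix.det_transpose, Matrix.det_nonsing_inv, hB, Ring.inverse_one]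
  · simp only [sigma]
    rw [← Ad_mul hF, ← Ad_mul hF, ← Matrix.transpose_mul, ← Matrix.transpose_mul,
      inv_mul_comm_of_commute hBA]

theorem mapsTo_theta (hn : 1 ≤ n) :
    Set.MapsTo (theta n) (universalCentralizer n) (universalCentralizer n) := by
  rintro ⟨B, A⟩ ⟨hB, hA, hBA⟩
  have hF := isUnit_det_Ftheta hn A
  have hBu : IsUnit (conjMat B).det := isUnit_det_conjMat (by rw [hB]; exact isUnit_one)
  have hAu := isUnit_det_conjMat (isUnit_det_crossSection hA)
  refine ⟨?_, Ad_Ftheta_mem_crossSection hn hA, ?_⟩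
  · simp only [theta]
    rw [det_Ad hF, det_conjMat, hB, map_one]
  · simp only [theta]
    rw [← Ad_mul hF, ← Ad_mul hF]
    have h : conjMat B * conjMat A = conjMat A * conjMat B := by
      rw [← conjMat_mul, ← conjMat_mul, hBA]
    congr 1
    rw [← Matrix.mul_nonsing_inv_cancel_right _ ((conjMat A)⁻¹ * conjMat B) hAu,
      Matrix.mul_assoc _ _ (conjMat A), h, Matrix.nonsing_inv_mul_cancel_left _ _ hAu]

/-! ### Smoothness of matrix valued maps -/

section Smooth

variable {E : Type*} [NormedAddCommGroup E] [NormedSpace ℝ E] {x : E} {f g : E → Mat n}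

/-- The norm is the entrywise sup norm, so smoothness of matrix operations reduces to that of
polynomials, conjugates and quotients of entries. -/
theorem contDiffAt_mat : ContDiffAt ℝ ∞ f x ↔ ∀ i j, ContDiffAt ℝ ∞ (fun y => f y i j) x :=
  contDiffAt_pi.trans (forall_congr' fun _ => contDiffAt_pi)

theorem contDiffAt_mat_mul (hf : ContDiffAt ℝ ∞ f x) (hg : ContDiffAt ℝ ∞ g x) :
    ContDiffAt ℝ ∞ (fun y => f y * g y) x := by
  rw [contDiffAt_mat] at *
  intro i j
  simp only [Matrix.mul_apply]
  exact ContDiffAt.sum fun k _ => (hf i k).mul (hg k j)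

theorem contDiffAt_mat_transpose (hf : ContDiffAt ℝ ∞ f x) :
    ContDiffAt ℝ ∞ (fun y => (f y)ᵀ) x := by
  rw [contDiffAt_mat] at *
  exact fun i j => hf j i

theorem contDiffAt_conjMat (hf : ContDiffAt ℝ ∞ f x) :
    ContDiffAt ℝ ∞ (fun y => conjMat (f y)) x := by
  rw [contDiffAt_mat] at *
  exact fun i j => Complex.conjCLE.contDiff.contDiffAt.comp x (hf i j)

theorem contDiffAt_det (hf : ContDiffAt ℝ ∞ f x) : ContDiffAt ℝ ∞ (fun y => (f y).det) x := by
  rw [contDiffAt_mat] at hf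
  simp only [Matrix.det_apply']
  exact ContDiffAt.sum fun s _ => contDiffAt_const.mul (contDiffAt_prod fun i _ => hf _ _)

theorem contDiffAt_adjugate (hf : ContDiffAt ℝ ∞ f x) :
    ContDiffAt ℝ ∞ (fun y => (f y).adjugate) x := by
  rw [contDiffAt_mat]
  intro i j
  simp only [Matrix.adjugate_apply]
  refine contDiffAt_det ?_
  rw [contDiffAt_mat] at hf ⊢
  intro k l
  simp only [Matrix.updateRow_apply]
  split_ifs
  · exact contDiffAt_const
  · exact hf k l

theorem contDiffAt_mat_inv (hf : ContDiffAt ℝ ∞ f x) (hx : IsUnit (f x).det) :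
    ContDiffAt ℝ ∞ (fun y => (f y)⁻¹) x := by
  have h := (contDiffAt_det hf).inv hx.ne_zero
  have h' := contDiffAt_adjugate hf
  rw [contDiffAt_mat] at h' ⊢
  intro i j
  simp only [Matrix.inv_def, Ring.inverse_eq_inv, Matrix.smul_apply, smul_eq_mul]
  exact h.mul (h' i j)

theorem contDiffAt_Ad (hf : ContDiffAt ℝ ∞ f x) (hg : ContDiffAt ℝ ∞ g x)
    (hx : IsUnit (f x).det) : ContDiffAt ℝ ∞ (fun y => Ad (f y) (g y)) x :=
  contDiffAt_mat_mul (contDiffAt_mat_mul hf hg) (contDiffAt_mat_inv hf hx)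

/-- Each entry of `factor` is either constant or an entry of `A Π̂⁻¹`, so `Q_m` is affine in `A`. -/
theorem contDiffAt_stokesFactor (m : ℤ) (hf : ContDiffAt ℝ ∞ f x) :
    ContDiffAt ℝ ∞ (fun y => stokesFactor n m (f y)) x := by
  refine contDiffAt_mat_mul (contDiffAt_mat_mul contDiffAt_const ?_) contDiffAt_const
  have h := contDiffAt_mat_mul hf (contDiffAt_const (c := (cyc n)⁻¹))
  rw [contDiffAt_mat] at h ⊢
  intro i j
  simp only [factor, Matrix.of_apply]
  split_ifs
  · exact h i j
  · exact contDiffAt_const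

theorem contDiffAt_stokesMatrix (hf : ContDiffAt ℝ ∞ f x) :
    ContDiffAt ℝ ∞ (fun y => stokesMatrix n (f y)) x := by
  have h : ∀ k : ℕ, ContDiffAt ℝ ∞
      (fun y => ((List.range k).map fun m : ℕ => stokesFactor n m (f y)).prod) x := by
    intro k
    induction k with
    | zero => simpa using contDiffAt_const
    | succ k ih =>
      simp only [List.range_succ, List.map_append, List.prod_append, List.map_singleton,
        List.prod_singleton]
      exact contDiffAt_mat_mul ih (contDiffAt_stokesFactor _ hf)
  exact h (n + 1)

theorem contDiffAt_Fsigma (hf : ContDiffAt ℝ ∞ f x) :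
    ContDiffAt ℝ ∞ (fun y => Fsigma n (f y)) x := by
  unfold Fsigma
  split_ifs
  · exact contDiffAt_const
  · exact contDiffAt_mat_transpose (contDiffAt_stokesMatrix hf)

theorem contDiffAt_Ftheta (hf : ContDiffAt ℝ ∞ f x) :
    ContDiffAt ℝ ∞ (fun y => Ftheta n (f y)) x := by
  unfold Ftheta
  split_ifs
  · exact contDiffAt_conjMat (contDiffAt_mat_mul contDiffAt_const (contDiffAt_stokesFactor _ hf))
  · exact contDiffAt_const

end Smooth

theorem isUnit_det_of_mem_universalCentralizer {p : Mat n × Mat n}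
    (hp : p ∈ universalCentralizer n) : IsUnit p.1.det ∧ IsUnit p.2.det :=
  ⟨by rw [hp.1]; exact isUnit_one, isUnit_det_crossSection hp.2.1⟩

theorem isSmoothAlong_sigma (hn : 1 ≤ n) : IsSmoothAlong (sigma n) (universalCentralizer n) := by
  intro p hp
  obtain ⟨hB, hA⟩ := isUnit_det_of_mem_universalCentralizer hp
  have hF := isUnit_det_Fsigma hn p.2
  have h := contDiffAt_Fsigma (n := n) (contDiffAt_snd (𝕜 := ℝ) (n := ∞) (p := p))
  exact (contDiffAt_Ad h (contDiffAt_mat_transpose (contDiffAt_mat_inv contDiffAt_fst hB)) hF).prodMk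
    (contDiffAt_Ad h (contDiffAt_mat_transpose (contDiffAt_mat_inv contDiffAt_snd hA)) hF)

theorem isSmoothAlong_theta (hn : 1 ≤ n) : IsSmoothAlong (theta n) (universalCentralizer n) := by
  intro p hp
  obtain ⟨hB, hA⟩ := isUnit_det_of_mem_universalCentralizer hp
  have hF := isUnit_det_Ftheta hn p.2
  have h := contDiffAt_Ftheta (n := n) (contDiffAt_snd (𝕜 := ℝ) (n := ∞) (p := p))
  exact (contDiffAt_Ad h (contDiffAt_conjMat contDiffAt_fst) hF).prodMk
    (contDiffAt_Ad h (contDiffAt_mat_inv (contDiffAt_conjMat contDiffAt_snd)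
      (isUnit_det_conjMat hA)) hF)

/-! ### Derivatives of curves of matrices -/

section Deriv

variable {f g : ℝ → Mat n} {f' g' : Mat n} {t : ℝ}

theorem hasDerivAt_mat : HasDerivAt f f' t ↔ ∀ i j, HasDerivAt (fun s => f s i j) (f' i j) t :=
  hasDerivAt_pi.trans (forall_congr' fun _ => hasDerivAt_pi)

theorem hasDerivAt_mat_mul (hf : HasDerivAt f f' t) (hg : HasDerivAt g g' t) :
    HasDerivAt (fun s => f s * g s) (f' * g t + f t * g') t := by
  rw [hasDerivAt_mat] at *
  intro i j
  simp only [Matrix.add_apply, Matrix.mul_apply, ← Finset.sum_add_distrib]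
  exact HasDerivAt.fun_sum fun k _ => (hf i k).mul (hg k j)

theorem hasDerivAt_mat_transpose (hf : HasDerivAt f f' t) :
    HasDerivAt (fun s => (f s)ᵀ) f'ᵀ t := by
  rw [hasDerivAt_mat] at *
  exact fun i j => hf j i

theorem hasDerivAt_conjMat (hf : HasDerivAt f f' t) :
    HasDerivAt (fun s => conjMat (f s)) (conjMat f') t := by
  rw [hasDerivAt_mat] at *
  exact fun i j => Complex.conjCLE.hasFDerivAt.comp_hasDerivAt t (hf i j)

/-- Differentiability comes from Cramer's rule; the value then follows by differentiating `f f⁻¹ =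
1`, valid near `t` where the determinant stays nonzero. -/
theorem hasDerivAt_mat_inv (hf : HasDerivAt f f' t) (hs : ContDiffAt ℝ ∞ f t)
    (ht : IsUnit (f t).det) : HasDerivAt (fun s => (f s)⁻¹) (-((f t)⁻¹ * f' * (f t)⁻¹)) t := by
  obtain ⟨d, hg⟩ : ∃ d, HasDerivAt (fun s => (f s)⁻¹) d t :=
    ⟨_, ((contDiffAt_mat_inv hs ht).differentiableAt (by simp)).hasDerivAt⟩
  have hc : ContinuousAt (fun s => (f s).det) t := (contDiffAt_det hs).continuousAt
  have hev : ∀ᶠ s in nhds t, f s * (f s)⁻¹ = 1 := by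
    filter_upwards [hc.eventually_ne ht.ne_zero] with s h
    exact Matrix.mul_nonsing_inv _ h.isUnit
  have h := (hasDerivAt_mat_mul hf hg).unique
    ((hasDerivAt_const t (1 : Mat n)).congr_of_eventuallyEq hev)
  have h' : f t * d = -(f' * (f t)⁻¹) := eq_neg_of_add_eq_zero_right h
  refine hg.congr_deriv ?_
  rw [← Matrix.nonsing_inv_mul_cancel_left (f t) d ht, h',
    Matrix.mul_neg, Matrix.mul_assoc]

/-- The derivative is arranged so that `f'` enters only through a commutator with `Ad_f g`, which
the 2-form does not see along the units. -/
theorem hasDerivAt_Ad (hf : HasDerivAt f f' t) (hs : ContDiffAt ℝ ∞ f t)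
    (ht : IsUnit (f t).det) (hg : HasDerivAt g g' t) :
    HasDerivAt (fun s => Ad (f s) (g s)) (Ad (f t) g' +
      (f' * (f t)⁻¹ * Ad (f t) (g t) - Ad (f t) (g t) * (f' * (f t)⁻¹))) t := by
  refine (hasDerivAt_mat_mul (hasDerivAt_mat_mul hf hg)
    (hasDerivAt_mat_inv hf hs ht)).congr_deriv ?_
  have h : f' * (f t)⁻¹ * Ad (f t) (g t) = f' * g t * (f t)⁻¹ := by
    simp only [Ad, Matrix.mul_assoc, Matrix.nonsing_inv_mul_cancel_left _ _ ht]
  rw [h]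
  simp only [Ad]
  noncomm_ring

end Deriv

/-! ### The 2-form along the units -/

/-- In the derivative of `BA = AB`, the terms containing the derivative of `A` cancel because `B =
I` at the base point. -/
theorem commute_of_isTangent {A : Mat n} {u : Mat n × Mat n}
    (hu : IsTangent (universalCentralizer n) (unit n A) u) : u.1 * A = A * u.1 := by
  obtain ⟨γ, -, hγ, h0, hd⟩ := hu
  have h1 : HasDerivAt (fun t => (γ t).1) u.1 0 := hd.fst
  have h2 : HasDerivAt (fun t => (γ t).2) u.2 0 := hd.snd
  have h := (hasDerivAt_mat_mul h1 h2).unique ((hasDerivAt_mat_mul h2 h1).congr_of_eventuallyEq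
    (hγ.mono fun t ht => ht.2.2))
  rw [h0] at h
  simp only [unit, Matrix.one_mul, Matrix.mul_one] at h
  exact add_right_cancel (h.trans (add_comm _ _))

theorem inv_commute {A X : Mat n} (hA : IsUnit A.det) (hX : X * A = A * X) :
    A⁻¹ * X = X * A⁻¹ := by
  rw [← Matrix.mul_nonsing_inv_cancel_right A (A⁻¹ * X) hA, Matrix.mul_assoc A⁻¹, hX,
    Matrix.nonsing_inv_mul_cancel_left _ _ hA]

/-- Since `Ad_A X = X`, the first term is `Tr(XY) - Tr(YX) = 0`. In the second, `θ^L` and `θ^R`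
contribute equally, which absorbs the factor `1/2`. -/
theorem omega_unit {A X Y : Mat n} (a b : Mat n) (hA : IsUnit A.det) (hX : X * A = A * X)
    (hY : Y * A = A * Y) : omega (unit n A) (X, a) (Y, b) =
      (X * (A⁻¹ * b)).trace - (Y * (A⁻¹ * a)).trace := by
  have key : ∀ {X : Mat n}, X * A = A * X → ∀ b : Mat n,
      (X * (A⁻¹ * b + b * A⁻¹)).trace = 2 * (X * (A⁻¹ * b)).trace := by
    intro X hX b
    have h : (X * (b * A⁻¹)).trace = (X * (A⁻¹ * b)).trace := by
      rw [← Matrix.mul_assoc, Matrix.trace_mul_comm, ← Matrix.mul_assoc, inv_commute hA hX,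
        Matrix.mul_assoc]
    rw [Matrix.mul_add, Matrix.trace_add, h, two_mul]
  have hAd : ∀ {X : Mat n}, X * A = A * X → Ad A X = X := fun hX =>
    Ad_eq_of_mul_eq hA hX.symm
  simp only [omega, wedge, unit, mcLeft, mcRight, inv_one, Matrix.one_mul, hAd hX, hAd hY, key hX,
    key hY]
  rw [Matrix.trace_mul_comm X Y]
  ring

/-- The two terms are `Tr(Y A⁻¹ Z A)` and `Tr(YZ)`, equal by cyclicity because `Y` commutes with
`A`. -/
theorem trace_mul_inv_mul_commutator {A Y : Mat n} (hA : IsUnit A.det) (hY : Y * A = A * Y)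
    (Z : Mat n) : (Y * (A⁻¹ * (Z * A - A * Z))).trace = 0 := by
  rw [Matrix.mul_sub, Matrix.mul_sub, Matrix.nonsing_inv_mul_cancel_left _ _ hA,
    Matrix.trace_sub, ← Matrix.mul_assoc A⁻¹, ← Matrix.mul_assoc Y, Matrix.trace_mul_comm,
    ← Matrix.mul_assoc, ← Matrix.mul_assoc, ← hY, Matrix.mul_nonsing_inv_cancel_right _ _ hA,
    sub_self]

/-- A derivative of the conjugating matrix does not contribute to the 2-form along the units. -/
theorem omega_unit_Ad {F A X Y : Mat n} (a b Z W : Mat n) (hF : IsUnit F.det) (hA : IsUnit A.det)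
    (hX : X * A = A * X) (hY : Y * A = A * Y) :
    omega (unit n (Ad F A)) (Ad F X, Ad F a + (Z * Ad F A - Ad F A * Z))
      (Ad F Y, Ad F b + (W * Ad F A - Ad F A * W)) = omega (unit n A) (X, a) (Y, b) := by
  have hA' : IsUnit (Ad F A).det := by rwa [det_Ad hF]
  have hX' : Ad F X * Ad F A = Ad F A * Ad F X := by rw [← Ad_mul hF, hX, Ad_mul hF]
  have hY' : Ad F Y * Ad F A = Ad F A * Ad F Y := by rw [← Ad_mul hF, hY, Ad_mul hF]
  rw [omega_unit _ _ hA' hX' hY', omega_unit _ _ hA hX hY]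
  simp only [Matrix.mul_add (Ad F A)⁻¹, Matrix.mul_add (Ad F X), Matrix.mul_add (Ad F Y),
    Matrix.trace_add, trace_mul_inv_mul_commutator hA' hX', trace_mul_inv_mul_commutator hA' hY',
    add_zero]
  simp only [← Ad_inv hF, ← Ad_mul hF, trace_Ad hF]

/-! ### Differentials of the two maps at the units, and the pullbacks. -/

theorem hasDerivAt_line {E : Type*} [NormedAddCommGroup E] [NormedSpace ℝ E] (p u : E) :
    HasDerivAt (fun t : ℝ => p + t • u) u 0 := by
  have h := ((hasDerivAt_id (0 : ℝ)).smul_const u).const_add p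
  rwa [one_smul] at h

theorem contDiffAt_line_mat (A a : Mat n) (t : ℝ) : ContDiffAt ℝ ∞ (fun t : ℝ => A + t • a) t :=
  contDiffAt_const.add (contDiffAt_id.smul contDiffAt_const)

/-- The differential of `(B, A) ↦ (Ad_{F(A)} β(B), Ad_{F(A)} α(A))` at a unit, up to a
commutator coming from the derivative of `F`. -/
theorem fderiv_Ad_prod {F α β : Mat n → Mat n} {A a' X' : Mat n} {u : Mat n × Mat n}
    (hFs : ContDiffAt ℝ ∞ F A) (hF : IsUnit (F A).det)
    (hφ : DifferentiableAt ℝ (fun p : Mat n × Mat n => (Ad (F p.2) (β p.1), Ad (F p.2) (α p.2)))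
      (unit n A))
    (hβ1 : β 1 = 1) (hβ : HasDerivAt (fun t : ℝ => β (1 + t • u.1)) X' 0)
    (hα : HasDerivAt (fun t : ℝ => α (A + t • u.2)) a' 0) :
    ∃ Z : Mat n, fderiv ℝ (fun p : Mat n × Mat n => (Ad (F p.2) (β p.1), Ad (F p.2) (α p.2)))
      (unit n A) u = (Ad (F A) X', Ad (F A) a' + (Z * Ad (F A) (α A) - Ad (F A) (α A) * Z)) := by
  -- The line may leave the centralizer; the formula for the map is differentiable at the unit in
  -- the ambient space of pairs, so this still computes the differential.
  have hline := hasDerivAt_line (unit n A) u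
  have e0 : unit n A + (0 : ℝ) • u = unit n A := by rw [zero_smul, add_zero]
  have h1 := HasFDerivAt.comp_hasDerivAt_of_eq (0 : ℝ) hφ.hasFDerivAt hline e0.symm
  have hFl : ContDiffAt ℝ ∞ (fun t : ℝ => F (A + t • u.2)) 0 :=
    ContDiffAt.comp (0 : ℝ) (by simpa using hFs) (contDiffAt_line_mat A u.2 0)
  have hFd := (hFl.differentiableAt (by simp)).hasDerivAt
  have hF0 : IsUnit (F (A + (0 : ℝ) • u.2)).det := by simpa using hF
  have h2 := (hasDerivAt_Ad hFd hFl hF0 hβ).prodMk (hasDerivAt_Ad hFd hFl hF0 hα)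
  refine ⟨deriv (fun t : ℝ => F (A + t • u.2)) 0 * (F A)⁻¹, (h1.unique h2).trans ?_⟩
  -- In the first component the commutator is taken with `Ad_F (β 1) = 1` and disappears.
  simp only [zero_smul, add_zero, hβ1, Ad_one hF, Matrix.mul_one, Matrix.one_mul, sub_self]
  rfl

theorem hasDerivAt_inv_line {A : Mat n} (hA : IsUnit A.det) (a : Mat n) :
    HasDerivAt (fun t : ℝ => (A + t • a)⁻¹) (-(A⁻¹ * a * A⁻¹)) 0 := by
  simpa using hasDerivAt_mat_inv (hasDerivAt_line A a) (contDiffAt_line_mat A a 0)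
    (by simpa using hA)

theorem unit_mem {A : Mat n} (hA : A ∈ crossSection n) : unit n A ∈ universalCentralizer n :=
  ⟨Matrix.det_one, hA, by simp [unit]⟩

theorem sigma_unit (hn : 1 ≤ n) (A : Mat n) :
    sigma n (unit n A) = unit n (Ad (Fsigma n A) (A⁻¹)ᵀ) := by
  simp [sigma, unit, Ad_one (isUnit_det_Fsigma hn A)]

theorem theta_unit (hn : 1 ≤ n) (A : Mat n) :
    theta n (unit n A) = unit n (Ad (Ftheta n A) (conjMat A)⁻¹) := by
  simp [theta, unit, conjMat_one, Ad_one (isUnit_det_Ftheta hn A)]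

theorem pullback_sigma (hn : 1 ≤ n) {A : Mat n} (hA : A ∈ crossSection n) {u v : Mat n × Mat n}
    (hu : u.1 * A = A * u.1) (hv : v.1 * A = A * v.1) :
    pullback (sigma n) omega (unit n A) u v = omega (unit n A) u v := by
  have hAu := isUnit_det_crossSection hA
  have hF := isUnit_det_Fsigma hn A
  have hφ := (isSmoothAlong_sigma hn _ (unit_mem hA)).differentiableAt (by simp)
  have hd : ∀ w : Mat n × Mat n, ∃ Z : Mat n, fderiv ℝ (sigma n) (unit n A) w =
      (Ad (Fsigma n A) (-w.1ᵀ), Ad (Fsigma n A) (-(A⁻¹ * w.2 * A⁻¹)ᵀ) +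
        (Z * Ad (Fsigma n A) (A⁻¹)ᵀ - Ad (Fsigma n A) (A⁻¹)ᵀ * Z)) := by
    intro w
    refine fderiv_Ad_prod (F := Fsigma n) (α := fun X => (X⁻¹)ᵀ) (β := fun X => (X⁻¹)ᵀ)
      (contDiffAt_Fsigma contDiffAt_id) hF hφ (by simp) ?_ ?_
    · simpa using hasDerivAt_mat_transpose
        (hasDerivAt_inv_line (A := (1 : Mat n)) (by simp) w.1)
    · simpa only [Matrix.transpose_neg] using
        hasDerivAt_mat_transpose (hasDerivAt_inv_line hAu w.2)
  have hAT : IsUnit ((A⁻¹)ᵀ).det := by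
    rw [Matrix.det_transpose]; exact Matrix.isUnit_nonsing_inv_det _ hAu
  have hc : ∀ {X : Mat n}, X * A = A * X → -Xᵀ * (A⁻¹)ᵀ = (A⁻¹)ᵀ * -Xᵀ := by
    intro X hX
    rw [Matrix.neg_mul, Matrix.mul_neg, ← Matrix.transpose_mul, ← Matrix.transpose_mul,
      inv_commute hAu hX]
  -- The signs from `-Xᵀ` and from the derivative of `A⁻¹` cancel; transposing under the trace gives
  -- back the original pairing.
  have ht : ∀ {X : Mat n} (b : Mat n),
      (-Xᵀ * (((A⁻¹)ᵀ)⁻¹ * -(A⁻¹ * b * A⁻¹)ᵀ)).trace = (X * (A⁻¹ * b)).trace := by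
    intro X b
    rw [← Matrix.transpose_nonsing_inv, Matrix.nonsing_inv_nonsing_inv _ hAu, Matrix.mul_neg,
      Matrix.neg_mul, Matrix.mul_neg, neg_neg, ← Matrix.transpose_mul,
      Matrix.nonsing_inv_mul_cancel_right _ _ hAu, ← Matrix.transpose_mul, Matrix.trace_transpose,
      Matrix.trace_mul_comm]
  obtain ⟨Z, hZ⟩ := hd u
  obtain ⟨W, hW⟩ := hd v
  rw [pullback, hZ, hW, sigma_unit hn, omega_unit_Ad _ _ _ _ hF hAT (hc hu) (hc hv),
    omega_unit _ _ hAT (hc hu) (hc hv), ht, ht, ← omega_unit _ _ hAu hu hv]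

theorem trace_conjMat (X : Mat n) : (conjMat X).trace = (starRingEnd ℂ) X.trace := by
  simp [Matrix.trace, conjMat]

theorem pullback_theta (hn : 1 ≤ n) {A : Mat n} (hA : A ∈ crossSection n) {u v : Mat n × Mat n}
    (hu : u.1 * A = A * u.1) (hv : v.1 * A = A * v.1) :
    pullback (theta n) omega (unit n A) u v = -(starRingEnd ℂ) (omega (unit n A) u v) := by
  have hAu := isUnit_det_crossSection hA
  have hAc := isUnit_det_conjMat hAu
  have hF := isUnit_det_Ftheta hn A
  have hφ := (isSmoothAlong_theta hn _ (unit_mem hA)).differentiableAt (by simp)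
  have hd : ∀ w : Mat n × Mat n, ∃ Z : Mat n, fderiv ℝ (theta n) (unit n A) w =
      (Ad (Ftheta n A) (conjMat w.1), Ad (Ftheta n A)
          (-((conjMat A)⁻¹ * conjMat w.2 * (conjMat A)⁻¹)) +
        (Z * Ad (Ftheta n A) (conjMat A)⁻¹ - Ad (Ftheta n A) (conjMat A)⁻¹ * Z)) := by
    intro w
    refine fderiv_Ad_prod (F := Ftheta n) (α := fun X => (conjMat X)⁻¹) (β := conjMat)
      (contDiffAt_Ftheta contDiffAt_id) hF hφ conjMat_one
      (hasDerivAt_conjMat (hasDerivAt_line 1 w.1)) ?_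
    simpa using hasDerivAt_mat_inv (hasDerivAt_conjMat (hasDerivAt_line A w.2))
      (contDiffAt_conjMat (contDiffAt_line_mat A w.2 0)) (by simpa using hAc)
  have hAi : IsUnit ((conjMat A)⁻¹).det := Matrix.isUnit_nonsing_inv_det _ hAc
  have hc0 : ∀ {X : Mat n}, X * A = A * X → conjMat X * (conjMat A)⁻¹ =
      (conjMat A)⁻¹ * conjMat X := by
    intro X hX
    rw [← conjMat_inv hAu, ← conjMat_mul, ← conjMat_mul, inv_commute hAu hX]
  -- Only the derivative of `Ā⁻¹` carries a sign. Commutation of `X` with `A` turns `Tr(X b A⁻¹)`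
  -- into `Tr(X A⁻¹ b)`.
  have ht : ∀ {X : Mat n}, X * A = A * X → ∀ b : Mat n,
      (conjMat X * ((conjMat A)⁻¹⁻¹ *
        -((conjMat A)⁻¹ * conjMat b * (conjMat A)⁻¹))).trace =
        -(starRingEnd ℂ) (X * (A⁻¹ * b)).trace := by
    intro X hX b
    rw [Matrix.mul_neg, Matrix.mul_neg, Matrix.trace_neg, Matrix.mul_assoc,
      Matrix.nonsing_inv_mul_cancel_left _ _ hAi, ← conjMat_inv hAu, ← conjMat_mul, ← conjMat_mul,
      trace_conjMat, ← Matrix.mul_assoc, Matrix.trace_mul_comm, ← Matrix.mul_assoc,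
      inv_commute hAu hX, Matrix.mul_assoc]
  obtain ⟨Z, hZ⟩ := hd u
  obtain ⟨W, hW⟩ := hd v
  rw [pullback, hZ, hW, theta_unit hn, omega_unit_Ad _ _ _ _ hF hAi (hc0 hu) (hc0 hv),
    omega_unit _ _ hAi (hc0 hu) (hc0 hv), ht hu, ht hv, ← Prod.mk.eta (p := u),
    ← Prod.mk.eta (p := v), omega_unit _ _ hAu hu hv, map_sub]
  ring

end

end Steinberg

theorem mainTheorem6 (n : ℕ) (hn : 1 ≤ n) :
    (Set.MapsTo (Steinberg.sigma n) (Steinberg.universalCentralizer n)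
        (Steinberg.universalCentralizer n) ∧
      Steinberg.IsSmoothAlong (Steinberg.sigma n) (Steinberg.universalCentralizer n) ∧
      ∀ A ∈ Steinberg.crossSection n, ∀ u v : Steinberg.Mat n × Steinberg.Mat n,
        Steinberg.IsTangent (Steinberg.universalCentralizer n) (Steinberg.unit n A) u →
        Steinberg.IsTangent (Steinberg.universalCentralizer n) (Steinberg.unit n A) v →
        Steinberg.pullback (Steinberg.sigma n) Steinberg.omega (Steinberg.unit n A) u v =
          Steinberg.omega (Steinberg.unit n A) u v) ∧
    (Set.MapsTo (Steinberg.theta n) (Steinberg.universalCentralizer n)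
        (Steinberg.universalCentralizer n) ∧
      Steinberg.IsSmoothAlong (Steinberg.theta n) (Steinberg.universalCentralizer n) ∧
      ∀ A ∈ Steinberg.crossSection n, ∀ u v : Steinberg.Mat n × Steinberg.Mat n,
        Steinberg.IsTangent (Steinberg.universalCentralizer n) (Steinberg.unit n A) u →
        Steinberg.IsTangent (Steinberg.universalCentralizer n) (Steinberg.unit n A) v →
        Steinberg.pullback (Steinberg.theta n) Steinberg.omega (Steinberg.unit n A) u v =
          -(starRingEnd ℂ) (Steinberg.omega (Steinberg.unit n A) u v)) :=
  ⟨⟨Steinberg.mapsTo_sigma hn, Steinberg.isSmoothAlong_sigma hn, fun _ hA _ _ hu hv =>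
    Steinberg.pullback_sigma hn hA (Steinberg.commute_of_isTangent hu)
      (Steinberg.commute_of_isTangent hv)⟩,
    Steinberg.mapsTo_theta hn, Steinberg.isSmoothAlong_theta hn, fun _ hA _ _ hu hv =>
    Steinberg.pullback_theta hn hA (Steinberg.commute_of_isTangent hu)
      (Steinberg.commute_of_isTangent hv)⟩
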